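/- Let $\Bbbk$ be a field of characteristic zero and let $n\in\mathbb N\cup\{\infty\}$. An $L_\infty$-algebra structure $\ell=\{\ell_1,\ell_2,\dots\}$ on a $\mathbb Z$-graded vector space $L$ (homological conventions, $\deg \ell_k=k-2$) is identified with the corresponding degree $-1$ codifferential $\delta$ on the conilpotent cocommutative coalgebra $S(\mathbf s L)$, $(\mathbf sL)_i=L_{i-1}$, and a (weak) $L_\infty$-morphism $f=\{f_1,f_2,\dots\}$, with $f_k\colon\Lambda^kL\to L'$ of degree $k-1$, with the corresponding morphism of coaugmented dg coalgebras $F\colon (S(\mathbf sL),\delta)\to (S(\mathbf sL'),\delta')$; here $$F^1_k=(-1)^{k(k-1)/2}\,\mathbf s\circ f_k\circ(\mathbf s^{-1})^{\otimes k},$$ where $F^1_k$ is the restriction of $F$ to words of length $k$ followed by the projection onto $\mathbf sL'$, and composition of $L_\infty$-morphisms is composition of the coalgebra morphisms. A Lie $n$-algebra is an $L_\infty$-algebra whose underlying graded vector space is concentrated in degrees $0,1,\dots,n-1$ (in degrees $\ge 0$ if $n=\infty$). A morphism $f$ of Lie $n$-algebras is a fibration if $f_1$ is surjective in all degrees $\geq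 1$; it is strict if $f_k=0$ for all $k\ge 2$; and it is an $L_\infty$-isomorphism if $f_1$ is an isomorphism of chain complexes, in which case $f$ has a two-sided inverse $L_\infty$-morphism. Let $f\colon (L,\ell)\to(L',\ell')$ be a fibration between Lie $n$-algebras. Then there exist a Lie $n$-algebra structure $\tilde\ell$ on the same graded vector space $L$ and an $L_\infty$-isomorphism $\phi\colon(L,\tilde\ell)\to(L,\ell)$ (with a two-sided inverse) such that $$f\phi\colon(L,\tilde\ell)\to(L',\ell')$$ is a strict fibration whose linear part is $(f\phi)_1=f_1$. -/

import Mathlib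

open scoped DirectSum TensorProduct

noncomputable section

namespace LieInfinity

universe u v w

/-! ### Graded vector spaces

A `ℤ`-graded vector space is a vector space `V` with a decomposition `V = ⨁ i, 𝒱 i` into
subspaces. -/

section Graded

variable {K : Type u} [Field K] {V : Type v} [AddCommGroup V] [Module K V]

/-- The suspension `sV` of a graded vector space, `(sV)_i = V_{i-1}`. The underlying vector space
is not changed, so that the map `s : V → sV` of degree one is the identity of `V`. -/
def susp (𝒱 : ℤ → Submodule K V) : ℤ → Submodule K V := fun i => 𝒱 (i - 1)

theorem susp_isInternal (𝒱 : ℤ → Submodule K V) [DirectSum.Decomposition 𝒱] :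
    DirectSum.IsInternal (susp 𝒱) := by
  have h := DirectSum.Decomposition.isInternal 𝒱
  rw [DirectSum.isInternal_submodule_iff_iSupIndep_and_iSup_eq_top] at h ⊢
  refine ⟨h.1.comp (f := fun i : ℤ => i - 1) (sub_left_injective), ?_⟩
  rw [← h.2]
  exact (Equiv.subRight (1 : ℤ)).iSup_comp (g := 𝒱)

instance suspDecomposition (𝒱 : ℤ → Submodule K V) [DirectSum.Decomposition 𝒱] :
    DirectSum.Decomposition (susp 𝒱) :=
  (susp_isInternal 𝒱).chooseDecomposition

/-- The linear involution `x ↦ (-1)^|x| x` of a graded vector space. -/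
def parity (𝒱 : ℤ → Submodule K V) [DirectSum.Decomposition 𝒱] : V →ₗ[K] V :=
  DirectSum.toModule K ℤ V (fun i => (-1 : ℤˣ) ^ i • (𝒱 i).subtype) ∘ₗ
    (DirectSum.decomposeLinearEquiv 𝒱).toLinearMap

theorem parity_apply_of_mem (𝒱 : ℤ → Submodule K V) [DirectSum.Decomposition 𝒱] {i : ℤ} {x : V}
    (hx : x ∈ 𝒱 i) : parity 𝒱 x = (-1 : ℤˣ) ^ i • x := by
  lift x to 𝒱 i using hx
  simp only [parity, LinearMap.comp_apply, LinearEquiv.coe_coe,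
    DirectSum.decomposeLinearEquiv_apply, DirectSum.decompose_coe]
  rw [← DirectSum.lof_eq_of K, DirectSum.toModule_lof]
  rfl

/-- The graded vector space is concentrated in degrees `0, 1, …, n - 1`, where `n ≤ ∞`. -/
def IsConcentrated (𝒱 : ℤ → Submodule K V) (n : ℕ∞) : Prop :=
  ∀ i : ℤ, 𝒱 i ≠ ⊥ → 0 ≤ i ∧ (i.toNat : ℕ∞) < n

end Graded

/-! ### The free graded commutative algebra `S(V)` -/

section Sym

variable {K : Type u} [Field K] {V : Type v} [AddCommGroup V] [Module K V]

/-- The relations `v w = (-1)^{|v||w|} w v` for homogeneous `v` and `w`. -/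
inductive SymRel (𝒱 : ℤ → Submodule K V) : TensorAlgebra K V → TensorAlgebra K V → Prop
  | comm (i j : ℤ) (v w : V) (hv : v ∈ 𝒱 i) (hw : w ∈ 𝒱 j) :
      SymRel 𝒱 (TensorAlgebra.ι K v * TensorAlgebra.ι K w)
        ((-1 : ℤˣ) ^ (i * j) • (TensorAlgebra.ι K w * TensorAlgebra.ι K v))

/-- The symmetric algebra `S(V)` of a graded vector space `V`. -/
def Sym (𝒱 : ℤ → Submodule K V) : Type (max u v) := RingQuot (SymRel 𝒱)

variable (𝒱 : ℤ → Submodule K V)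

instance : Ring (Sym 𝒱) := inferInstanceAs (Ring (RingQuot (SymRel 𝒱)))

instance : Algebra K (Sym 𝒱) := inferInstanceAs (Algebra K (RingQuot (SymRel 𝒱)))

namespace Sym

/-- The inclusion of the generators `V → S(V)`. -/
def ι : V →ₗ[K] Sym 𝒱 :=
  (RingQuot.mkAlgHom K (SymRel 𝒱)).toLinearMap ∘ₗ TensorAlgebra.ι K

variable {𝒱}

theorem ι_mul_ι {i j : ℤ} {v w : V} (hv : v ∈ 𝒱 i) (hw : w ∈ 𝒱 j) :
    ι 𝒱 v * ι 𝒱 w = (-1 : ℤˣ) ^ (i * j) • (ι 𝒱 w * ι 𝒱 v) := by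
  have h := RingQuot.mkAlgHom_rel K (SymRel.comm i j v w hv hw)
  rw [Units.smul_def, map_zsmul, map_mul, map_mul, ← Units.smul_def] at h
  exact h

/-- The universal property of `S(V)`. -/
def lift {A : Type w} [Ring A] [Algebra K A] (f : V →ₗ[K] A)
    (hf : ∀ (i j : ℤ) (v w : V), v ∈ 𝒱 i → w ∈ 𝒱 j →
      f v * f w = (-1 : ℤˣ) ^ (i * j) • (f w * f v)) : Sym 𝒱 →ₐ[K] A :=
  RingQuot.liftAlgHom K ⟨TensorAlgebra.lift K f, by
    rintro _ _ ⟨i, j, v, w, hv, hw⟩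
    rw [Units.smul_def, map_zsmul, map_mul, map_mul, ← Units.smul_def]
    simpa using hf i j v w hv hw⟩

@[simp]
theorem lift_ι {A : Type w} [Ring A] [Algebra K A] (f : V →ₗ[K] A)
    (hf : ∀ (i j : ℤ) (v w : V), v ∈ 𝒱 i → w ∈ 𝒱 j →
      f v * f w = (-1 : ℤˣ) ^ (i * j) • (f w * f v)) (v : V) : lift f hf (ι 𝒱 v) = f v := by
  have h := RingQuot.liftAlgHom_mkAlgHom_apply K (TensorAlgebra.lift K f) (s := SymRel 𝒱)
    (by
      rintro _ _ ⟨i, j, v, w, hv, hw⟩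
      rw [Units.smul_def, map_zsmul, map_mul, map_mul, ← Units.smul_def]
      simpa using hf i j v w hv hw) (TensorAlgebra.ι K v)
  exact h.trans (TensorAlgebra.lift_ι_apply f v)

theorem algHom_ext {A : Type w} [Ring A] [Algebra K A] {f g : Sym 𝒱 →ₐ[K] A}
    (h : ∀ v, f (ι 𝒱 v) = g (ι 𝒱 v)) : f = g := by
  apply RingQuot.ringQuot_ext'
  apply TensorAlgebra.hom_ext
  ext v
  exact h v

variable (𝒱)

/-- The algebra morphism from `S(V)` to the square-zero extension `K ⊕ V` with `v ↦ (0, v)`. -/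
def toTrivSqZeroExt [Module Kᵐᵒᵖ V] [IsCentralScalar K V] : Sym 𝒱 →ₐ[K] TrivSqZeroExt K V :=
  lift (𝒱 := 𝒱) (TrivSqZeroExt.inrHom K V) (fun _ _ v w _ _ => by
    simp only [TrivSqZeroExt.inrHom_apply, TrivSqZeroExt.inr_mul_inr, smul_zero])

/-- The projection `S(V) → V` onto the words of length one. -/
def proj : Sym 𝒱 →ₗ[K] V :=
  letI : Module Kᵐᵒᵖ V := Module.compHom _ ((RingHom.id K).fromOpposite mul_comm)
  haveI : IsCentralScalar K V := ⟨fun _ _ => rfl⟩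
  TrivSqZeroExt.sndHom K V ∘ₗ (toTrivSqZeroExt 𝒱).toLinearMap

theorem proj_ι (v : V) : proj 𝒱 (ι 𝒱 v) = v := by
  let : Module Kᵐᵒᵖ V := Module.compHom _ ((RingHom.id K).fromOpposite mul_comm)
  have : IsCentralScalar K V := ⟨fun _ _ => rfl⟩
  have h : (toTrivSqZeroExt 𝒱 (ι 𝒱 v)).snd = v := by simp [toTrivSqZeroExt]
  exact h

theorem proj_one : proj 𝒱 1 = 0 := by
  let : Module Kᵐᵒᵖ V := Module.compHom _ ((RingHom.id K).fromOpposite mul_comm)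
  have : IsCentralScalar K V := ⟨fun _ _ => rfl⟩
  have h : (toTrivSqZeroExt 𝒱 1).snd = 0 := by simp
  exact h

theorem proj_ι_mul_ι_mul (v w : V) (x : Sym 𝒱) : proj 𝒱 (ι 𝒱 v * (ι 𝒱 w * x)) = 0 := by
  let : Module Kᵐᵒᵖ V := Module.compHom _ ((RingHom.id K).fromOpposite mul_comm)
  have : IsCentralScalar K V := ⟨fun _ _ => rfl⟩
  have h : (toTrivSqZeroExt 𝒱 (ι 𝒱 v * (ι 𝒱 w * x))).snd = 0 := by
    simp [toTrivSqZeroExt, ← mul_assoc]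
  exact h

/-- The subspace of `S(V)` of elements of degree `i`, spanned by the products `v₁ v₂ ⋯ vₘ` of
homogeneous elements of `V` with `|v₁| + ⋯ + |vₘ| = i`. -/
def gr (i : ℤ) : Submodule K (Sym 𝒱) :=
  Submodule.span K {x | ∃ l : List (Σ j : ℤ, 𝒱 j),
    (l.map (fun p => p.1)).sum = i ∧ (l.map (fun p => ι 𝒱 (p.2 : V))).prod = x}

theorem ι_mem_gr {i : ℤ} {v : V} (hv : v ∈ 𝒱 i) : ι 𝒱 v ∈ gr 𝒱 i :=
  Submodule.subset_span ⟨[⟨i, v, hv⟩], by simp, by simp⟩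

instance grGradedMonoid : SetLike.GradedMonoid (gr 𝒱) where
  one_mem := Submodule.subset_span ⟨[], by simp, by simp⟩
  mul_mem := by
    intro i j x y hx hy
    have h := Submodule.mul_mem_mul hx hy
    rw [gr, gr, Submodule.span_mul_span] at h
    refine Submodule.span_mono ?_ h
    rintro _ ⟨_, ⟨l, rfl, rfl⟩, _, ⟨l', rfl, rfl⟩, rfl⟩
    exact ⟨l ++ l', by simp, by simp⟩

variable [DirectSum.Decomposition 𝒱]

theorem linearMap_ext_graded {M : Type w} [AddCommGroup M] [Module K M] {f g : V →ₗ[K] M}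
    (h : ∀ i, ∀ v ∈ 𝒱 i, f v = g v) : f = g := by
  refine DirectSum.decompose_lhom_ext 𝒱 fun i => ?_
  ext v
  exact h i v v.2

/-- The map `V → ⨁ i, S(V)_i`. -/
def grι : V →ₗ[K] ⨁ i, gr 𝒱 i :=
  DirectSum.toModule K ℤ _ (fun i => DirectSum.lof K ℤ (fun i => gr 𝒱 i) i ∘ₗ
    ((ι 𝒱).restrict (p := 𝒱 i) (q := gr 𝒱 i) fun _ hv => ι_mem_gr 𝒱 hv)) ∘ₗ
    (DirectSum.decomposeLinearEquiv 𝒱).toLinearMap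

theorem grι_apply_of_mem {i : ℤ} {v : V} (hv : v ∈ 𝒱 i) :
    grι 𝒱 v = DirectSum.of (fun i => gr 𝒱 i) i ⟨ι 𝒱 v, ι_mem_gr 𝒱 hv⟩ := by
  lift v to 𝒱 i using hv
  simp only [grι, LinearMap.comp_apply, LinearEquiv.coe_coe,
    DirectSum.decomposeLinearEquiv_apply, DirectSum.decompose_coe]
  rw [← DirectSum.lof_eq_of K, DirectSum.toModule_lof]
  rfl

theorem grι_mul_grι (i j : ℤ) (v w : V) (hv : v ∈ 𝒱 i) (hw : w ∈ 𝒱 j) :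
    grι 𝒱 v * grι 𝒱 w = (-1 : ℤˣ) ^ (i * j) • (grι 𝒱 w * grι 𝒱 v) := by
  rw [grι_apply_of_mem 𝒱 hv, grι_apply_of_mem 𝒱 hw, DirectSum.of_mul_of, DirectSum.of_mul_of,
    Units.smul_def]
  refine Eq.trans ?_ (map_zsmul (DirectSum.of (fun i => gr 𝒱 i) (j + i)) _ _)
  refine DirectSum.of_eq_of_gradedMonoid_eq (Sigma.subtype_ext (add_comm _ _) ?_)
  exact (ι_mul_ι hv hw).trans (Units.smul_def _ _)

/-- The decomposition of `S(V)` into homogeneous components, as an algebra morphism. -/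
def grLift : Sym 𝒱 →ₐ[K] ⨁ i, gr 𝒱 i :=
  lift (𝒱 := 𝒱) (A := ⨁ i, gr 𝒱 i) (grι 𝒱) (grι_mul_grι 𝒱)

theorem grLift_ι (v : V) : grLift 𝒱 (ι 𝒱 v) = grι 𝒱 v :=
  lift_ι _ _ v

theorem grLift_prod (l : List (Σ j : ℤ, 𝒱 j))
    (hl : (l.map fun p => ι 𝒱 (p.2 : V)).prod ∈ gr 𝒱 (l.map fun p => p.1).sum) :
    grLift 𝒱 (l.map fun p => ι 𝒱 (p.2 : V)).prod =
      DirectSum.of (fun i => gr 𝒱 i) (l.map fun p => p.1).sum ⟨_, hl⟩ := by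
  induction l with
  | nil => simp only [List.map_nil, List.prod_nil, map_one]; rfl
  | cons p l ih =>
    have hl' : (l.map fun p => ι 𝒱 (p.2 : V)).prod ∈ gr 𝒱 (l.map fun p => p.1).sum :=
      Submodule.subset_span ⟨l, rfl, rfl⟩
    simp only [List.map_cons, List.prod_cons, map_mul, ih hl', grLift_ι,
      grι_apply_of_mem 𝒱 p.2.2, DirectSum.of_mul_of]
    exact DirectSum.of_eq_of_gradedMonoid_eq
      (Sigma.subtype_ext (List.sum_cons (a := p.1)).symm rfl)

/-- `S(V)` is a graded algebra for the degree inherited from `V`. -/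
instance gradedAlgebra : GradedAlgebra (gr 𝒱) :=
  GradedAlgebra.ofAlgHom (gr 𝒱) (grLift 𝒱)
    (by
      apply algHom_ext
      intro v
      have h : (DirectSum.coeAlgHom (gr 𝒱)).toLinearMap ∘ₗ grι 𝒱 = ι 𝒱 := by
        refine linearMap_ext_graded 𝒱 fun i v hv => ?_
        rw [LinearMap.comp_apply, grι_apply_of_mem 𝒱 hv]
        exact DirectSum.coeAlgHom_of (gr 𝒱) i _
      rw [AlgHom.comp_apply, grLift_ι]
      exact LinearMap.congr_fun h v)
    (by
      rintro i ⟨x, hx⟩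
      change grLift 𝒱 x = _
      induction hx using Submodule.span_induction with
      | mem x h =>
        obtain ⟨l, rfl, rfl⟩ := h
        exact grLift_prod 𝒱 l _
      | zero =>
        rw [map_zero]
        exact (map_zero (DirectSum.of (fun i => gr 𝒱 i) i)).symm
      | add x y hx hy ihx ihy =>
        rw [map_add, ihx, ihy]
        exact (map_add (DirectSum.of (fun i => gr 𝒱 i) i) ⟨x, hx⟩ ⟨y, hy⟩).symm
      | smul a x hx ih =>
        rw [map_smul, ih]
        exact (map_smul (DirectSum.lof K ℤ (fun i => gr 𝒱 i) i) a ⟨x, hx⟩).symm)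

/-- `v ↦ v ⊗ 1 + 1 ⊗ v`. -/
def comulι : V →ₗ[K] (gr 𝒱 ᵍ⊗[K] gr 𝒱) :=
  (GradedTensorProduct.includeLeft (gr 𝒱) (gr 𝒱)).toLinearMap ∘ₗ ι 𝒱 +
    (GradedTensorProduct.includeRight (gr 𝒱) (gr 𝒱)).toLinearMap ∘ₗ ι 𝒱

theorem comulι_mul_comulι (i j : ℤ) (v w : V) (hv : v ∈ 𝒱 i) (hw : w ∈ 𝒱 j) :
    comulι 𝒱 v * comulι 𝒱 w = (-1 : ℤˣ) ^ (i * j) • (comulι 𝒱 w * comulι 𝒱 v) := by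
  have key : ∀ (i j : ℤ) (v w : V), v ∈ 𝒱 i → w ∈ 𝒱 j → comulι 𝒱 v * comulι 𝒱 w =
      GradedTensorProduct.tmul K (ι 𝒱 v * ι 𝒱 w) 1 + GradedTensorProduct.tmul K (ι 𝒱 v) (ι 𝒱 w) +
      ((-1 : ℤˣ) ^ (i * j) • GradedTensorProduct.tmul K (ι 𝒱 w) (ι 𝒱 v) +
        GradedTensorProduct.tmul K 1 (ι 𝒱 v * ι 𝒱 w)) := by
    intro i j v w hv hw
    have h1 := GradedTensorProduct.tmul_one_mul_coe_tmul (R := K) (gr 𝒱) (gr 𝒱) (ι 𝒱 v)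
      ⟨_, ι_mem_gr 𝒱 hw⟩ 1
    have h2 := GradedTensorProduct.tmul_one_mul_one_tmul (R := K) (gr 𝒱) (gr 𝒱) (ι 𝒱 v) (ι 𝒱 w)
    have h3 := GradedTensorProduct.tmul_coe_mul_coe_tmul (R := K) (gr 𝒱) (gr 𝒱) 1
      ⟨_, ι_mem_gr 𝒱 hv⟩ ⟨_, ι_mem_gr 𝒱 hw⟩ 1
    have h4 := GradedTensorProduct.tmul_coe_mul_one_tmul (R := K) (gr 𝒱) (gr 𝒱) 1
      ⟨_, ι_mem_gr 𝒱 hv⟩ (ι 𝒱 w)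
    simp only [one_mul, mul_one] at h3
    simp only [comulι, LinearMap.add_apply, LinearMap.comp_apply, AlgHom.toLinearMap_apply,
      GradedTensorProduct.includeLeft_apply, GradedTensorProduct.includeRight_apply, add_mul,
      mul_add]
    rw [h1, h2, h3, h4]
    abel
  have hs : ((-1 : ℤˣ) ^ (i * j)) * ((-1 : ℤˣ) ^ (j * i)) = 1 := by
    rw [mul_comm j i]; exact Int.units_mul_self _
  have hl : GradedTensorProduct.tmul K (ι 𝒱 v * ι 𝒱 w) 1 = (-1 : ℤˣ) ^ (i * j) •
      (GradedTensorProduct.tmul K (ι 𝒱 w * ι 𝒱 v) 1 : gr 𝒱 ᵍ⊗[K] gr 𝒱) := by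
    rw [ι_mul_ι hv hw, Units.smul_def, Units.smul_def]
    exact map_zsmul (GradedTensorProduct.includeLeft (gr 𝒱) (gr 𝒱)) _ _
  have hr : GradedTensorProduct.tmul K 1 (ι 𝒱 v * ι 𝒱 w) = (-1 : ℤˣ) ^ (i * j) •
      (GradedTensorProduct.tmul K 1 (ι 𝒱 w * ι 𝒱 v) : gr 𝒱 ᵍ⊗[K] gr 𝒱) := by
    rw [ι_mul_ι hv hw, Units.smul_def, Units.smul_def]
    exact map_zsmul (GradedTensorProduct.includeRight (gr 𝒱) (gr 𝒱)) _ _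
  rw [key i j v w hv hw, key j i w v hw hv, hl, hr, smul_add, smul_add, smul_add, smul_smul, hs,
    one_smul]
  abel

/-- The comultiplication of `S(V)` as the morphism of algebras `S(V) → S(V) ⊗ S(V)` with
`v ↦ v ⊗ 1 + 1 ⊗ v`; the target has the multiplication
`(a ⊗ b) (a' ⊗ b') = (-1)^{|b||a'|} a a' ⊗ b b'`. -/
def comulAlgHom : Sym 𝒱 →ₐ[K] (gr 𝒱 ᵍ⊗[K] gr 𝒱) :=
  lift (𝒱 := 𝒱) (comulι 𝒱) (comulι_mul_comulι 𝒱)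

/-- The coalgebra structure of `S(V)`; the counit is the projection to the scalars. -/
instance : CoalgebraStruct K (Sym 𝒱) where
  comul := (GradedTensorProduct.of K (gr 𝒱) (gr 𝒱)).symm.toLinearMap ∘ₗ (comulAlgHom 𝒱).toLinearMap
  counit := (lift (𝒱 := 𝒱) (0 : V →ₗ[K] K) (fun _ _ _ _ _ _ => by
    simp only [LinearMap.zero_apply, mul_zero, smul_zero])).toLinearMap

end Sym

end Sym

/-! ### `L∞`-algebras and their morphisms -/

section LInfinity

variable {K : Type u} [Field K]

section Components

variable {L : Type v} [AddCommGroup L] [Module K L] (ℒ : ℤ → Submodule K L)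
  [DirectSum.Decomposition ℒ]
  {L' : Type w} [AddCommGroup L'] [Module K L'] (ℒ' : ℤ → Submodule K L')

/-- The `k`-ary map `φₖ : L × ⋯ × L → L'` encoded by a linear map `Φ : S(sL) → S(sL')`. Its
structure map `Φ¹ₖ`, the restriction of `Φ` to words of length `k` followed by the projection to
`sL'`, satisfies `Φ¹ₖ = (-1)^{k(k-1)/2} s ∘ φₖ ∘ (s⁻¹)^{⊗k}`. With the Koszul sign of
`(s⁻¹)^{⊗k}` this says, for homogeneous `x₁, …, xₖ` in `L`,
`φₖ(x₁, …, xₖ) = (-1)^{∑ⱼ (k-j)|xⱼ|} s⁻¹ Φ¹ₖ(s x₁, …, s xₖ)`. -/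
def component (Φ : Sym (susp ℒ) →ₗ[K] Sym (susp ℒ')) (k : ℕ) :
    MultilinearMap K (fun _ : Fin k => L) L' :=
  (Sym.proj (susp ℒ') ∘ₗ Φ).compMultilinearMap
    ((MultilinearMap.mkPiAlgebraFin K k (Sym (susp ℒ))).compLinearMap
      (fun j => Sym.ι (susp ℒ) ∘ₗ parity ℒ ^ (k - 1 - (j : ℕ))))

end Components

/-- An `L∞`-algebra structure on the graded vector space `L`: a codifferential on the coalgebra
`S(sL)`, that is, a coderivation `δ` of degree `-1` with `δ 1 = 0` and `δ² = 0`. -/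
structure LInfinityAlgebra {L : Type v} [AddCommGroup L] [Module K L] (ℒ : ℤ → Submodule K L)
    [DirectSum.Decomposition ℒ] where
  /-- The codifferential. -/
  δ : Sym (susp ℒ) →ₗ[K] Sym (susp ℒ)
  degree : ∀ i : ℤ, ∀ x ∈ Sym.gr (susp ℒ) i, δ x ∈ Sym.gr (susp ℒ) (i - 1)
  map_one : δ 1 = 0
  /-- `Δ δ = (δ ⊗ 1 + 1 ⊗ δ) Δ`, where `(1 ⊗ δ) (x ⊗ y) = (-1)^|x| x ⊗ δ y`. -/
  coderivation : CoalgebraStruct.comul ∘ₗ δ =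
    (TensorProduct.map δ LinearMap.id + TensorProduct.map (parity (Sym.gr (susp ℒ))) δ) ∘ₗ
      CoalgebraStruct.comul
  sq_zero : δ ∘ₗ δ = 0

section Hom

variable {L : Type v} [AddCommGroup L] [Module K L] {ℒ : ℤ → Submodule K L}
  [DirectSum.Decomposition ℒ]
  {L' : Type w} [AddCommGroup L'] [Module K L'] {ℒ' : ℤ → Submodule K L'}
  [DirectSum.Decomposition ℒ']

/-- The bracket `ℓₖ` of an `L∞`-algebra. -/
def LInfinityAlgebra.bracket (A : LInfinityAlgebra ℒ) (k : ℕ) :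
    MultilinearMap K (fun _ : Fin k => L) L :=
  component ℒ ℒ A.δ k

/-- A (weak) `L∞`-morphism: a morphism `S(sL) → S(sL')` of coaugmented dg coalgebras. -/
structure LInfinityHom (A : LInfinityAlgebra ℒ) (A' : LInfinityAlgebra ℒ') where
  /-- The morphism of coalgebras. -/
  F : Sym (susp ℒ) →ₗc[K] Sym (susp ℒ')
  degree : ∀ i : ℤ, ∀ x ∈ Sym.gr (susp ℒ) i, F x ∈ Sym.gr (susp ℒ') i
  map_one : F 1 = 1
  comm : F.toLinearMap ∘ₗ A.δ = A'.δ ∘ₗ F.toLinearMap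

namespace LInfinityHom

/-- The identity morphism. -/
def id (A : LInfinityAlgebra ℒ) : LInfinityHom A A where
  F := CoalgHom.id K _
  degree _ _ hx := hx
  map_one := rfl
  comm := rfl

variable {A : LInfinityAlgebra ℒ} {A' : LInfinityAlgebra ℒ'}

/-- The composition `g f` of `L∞`-morphisms, i.e. of morphisms of dg coalgebras. -/
def comp {L'' : Type*} [AddCommGroup L''] [Module K L''] {ℒ'' : ℤ → Submodule K L''}
    [DirectSum.Decomposition ℒ''] {A'' : LInfinityAlgebra ℒ''}
    (g : LInfinityHom A' A'') (f : LInfinityHom A A') : LInfinityHom A A'' where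
  F := g.F.comp f.F
  degree i x hx := g.degree i _ (f.degree i x hx)
  map_one := by rw [CoalgHom.comp_apply, f.map_one, g.map_one]
  comm := by
    ext x
    have h1 : f.F (A.δ x) = A'.δ (f.F x) := LinearMap.congr_fun f.comm x
    have h2 : g.F (A'.δ (f.F x)) = A''.δ (g.F (f.F x)) := LinearMap.congr_fun g.comm (f.F x)
    exact (congrArg g.F h1).trans h2

/-- The `k`-ary map `fₖ` of an `L∞`-morphism `f`. -/
def map (f : LInfinityHom A A') (k : ℕ) : MultilinearMap K (fun _ : Fin k => L) L' :=
  component ℒ ℒ' f.F.toLinearMap k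

/-- The linear part `f₁ : L → L'`. -/
def linearPart (f : LInfinityHom A A') : L →ₗ[K] L' :=
  Sym.proj (susp ℒ') ∘ₗ f.F.toLinearMap ∘ₗ Sym.ι (susp ℒ)

theorem map_one_apply (f : LInfinityHom A A') (x : Fin 1 → L) :
    f.map 1 x = f.linearPart (x 0) := by
  simp [map, component, linearPart, MultilinearMap.mkPiAlgebraFin_apply]

/-- `f` is strict: `fₖ = 0` for all `k ≥ 2`. -/
def IsStrict (f : LInfinityHom A A') : Prop :=
  ∀ k : ℕ, 2 ≤ k → f.map k = 0

/-- `f` is a fibration: `f₁` is surjective in all positive degrees. -/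
def IsFibration (f : LInfinityHom A A') : Prop :=
  ∀ i : ℤ, 0 < i → ∀ y ∈ ℒ' i, ∃ x ∈ ℒ i, f.linearPart x = y

/-- `f` is an `L∞`-isomorphism: `f₁` is an isomorphism of chain complexes, and `f` has a two-sided
inverse. -/
def IsIso (f : LInfinityHom A A') : Prop :=
  Function.Bijective f.linearPart ∧
    ∃ g : LInfinityHom A' A, f.comp g = LInfinityHom.id A' ∧ g.comp f = LInfinityHom.id A

end LInfinityHom

end Hom

end LInfinity

end LieInfinity

end

/-!
Write `V = sL` and `W = sL'`; both are concentrated in degrees `≥ 1`. The theorem is a statement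
about coalgebra morphisms only: if `e` is an automorphism of the graded coalgebra `S(V)`, the
codifferential can be transported along `e`, and `e⁻¹` becomes an `L∞`-isomorphism
(`LInfinityAlgebra.exists_iso_of_coalgEquiv`). So it suffices to find an `e` with trivial linear
part and `S(F₁) ∘ e = F`, where `F : S(V) → S(W)` is the given morphism with linear part `F₁`, since
then `F ∘ e⁻¹ = S(F₁)` is strict (`Sym.exists_coalgEquiv_map_comp`).

Coalgebra morphisms into `S(W)` are exponentials. In the convolution algebra of linear maps from
`S(V)` to an algebra, a map `h` of degree zero with values in the generators `W` has a locally
finite exponential `exp h = ∑ hⁿ / n!`, because the generators have positive degree. It is a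
coalgebra morphism, since elements of `W` are primitive and the exponential law holds for commuting
maps (`Sym.comul_convExp_toGen`). The identity is the exponential of the projection to the
generators (`Sym.convExp_toGen_proj`), so every coalgebra morphism `F` is the exponential of its
corestriction `F¹ : S(V) → W` (`Sym.convExp_toGen_proj_comp`).

On words of length at least two, `F¹` has values in degrees `≥ 2`, where `F₁` has a section `σ`.
Take for `e` the exponential of `pr + σ (F¹ - F₁ pr)`, with `pr : S(V) → V` the projection. The
algebra morphism `S(F₁)` commutes with exponentials, hence `S(F₁) ∘ e` is the exponential of
`F₁ pr + F₁ σ (F¹ - F₁ pr) = F¹`, which is `F`. Finally `e` is the identity up to terms of smaller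
word length (`Sym.convExp_toGen_sub_mem_len`), and therefore bijective.
-/

noncomputable section

namespace LieInfinity

/-! ### Signs and gradings -/

section Graded

variable {K : Type*} [Field K] {V : Type*} [AddCommGroup V] [Module K V]

theorem map_intUnits_smul {M N F : Type*} [AddCommGroup M] [AddCommGroup N] [FunLike F M N]
    [AddMonoidHomClass F M N] (f : F) (u : ℤˣ) (x : M) : f (u • x) = u • f x := by
  rw [Units.smul_def, Units.smul_def, map_zsmul]

variable (𝒱 : ℤ → Submodule K V) [DirectSum.Decomposition 𝒱]

/-- The linear map on a graded vector space that is `φ j` on elements of degree `j`. -/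
def gradedMap {M : Type*} [AddCommGroup M] [Module K M] (φ : ℤ → V →ₗ[K] M) : V →ₗ[K] M :=
  DirectSum.toModule K ℤ M (fun j => φ j ∘ₗ (𝒱 j).subtype) ∘ₗ
    (DirectSum.decomposeLinearEquiv 𝒱).toLinearMap

theorem gradedMap_apply {M : Type*} [AddCommGroup M] [Module K M] (φ : ℤ → V →ₗ[K] M)
    {j : ℤ} {x : V} (hx : x ∈ 𝒱 j) : gradedMap 𝒱 φ x = φ j x := by
  lift x to 𝒱 j using hx
  simp only [gradedMap, LinearMap.comp_apply, LinearEquiv.coe_coe,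
    DirectSum.decomposeLinearEquiv_apply, DirectSum.decompose_coe]
  rw [← DirectSum.lof_eq_of K, DirectSum.toModule_lof]
  rfl

/-- The Koszul sign `x ↦ (-1)^{i|x|} x` of moving an operator of degree `i` past `x`. -/
def koszul (i : ℤ) : V →ₗ[K] V :=
  gradedMap 𝒱 fun j => (-1 : ℤˣ) ^ (i * j) • LinearMap.id

theorem koszul_apply {i j : ℤ} {x : V} (hx : x ∈ 𝒱 j) :
    koszul 𝒱 i x = (-1 : ℤˣ) ^ (i * j) • x :=
  gradedMap_apply 𝒱 _ hx

theorem koszul_mem {i j : ℤ} {x : V} (hx : x ∈ 𝒱 j) : koszul 𝒱 i x ∈ 𝒱 j := by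
  rw [koszul_apply 𝒱 hx, Units.smul_def]
  exact zsmul_mem hx _

end Graded

/-! ### The coalgebra `S(V)` -/

namespace Sym

variable {K : Type*} [Field K] {V : Type*} [AddCommGroup V] [Module K V]
  {𝒱 : ℤ → Submodule K V}

/-- A product of homogeneous elements of `V`. -/
def word (l : List (Σ j : ℤ, 𝒱 j)) : Sym 𝒱 := (l.map fun p => ι 𝒱 (p.2 : V)).prod

theorem word_nil : word ([] : List (Σ j : ℤ, 𝒱 j)) = 1 := rfl

theorem word_cons (p : Σ j : ℤ, 𝒱 j) (l : List (Σ j : ℤ, 𝒱 j)) :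
    word (p :: l) = ι 𝒱 (p.2 : V) * word l := by simp [word]

theorem word_mem_gr (l : List (Σ j : ℤ, 𝒱 j)) : word l ∈ gr 𝒱 (l.map fun p => p.1).sum :=
  Submodule.subset_span ⟨l, rfl, rfl⟩

theorem gr_eq_span (d : ℤ) :
    gr 𝒱 d = Submodule.span K {x | ∃ l : List (Σ j : ℤ, 𝒱 j),
      (l.map fun p => p.1).sum = d ∧ word l = x} := rfl

theorem one_mem_gr : (1 : Sym 𝒱) ∈ gr 𝒱 0 := word_mem_gr []

theorem ι_mul_mem_gr {i d : ℤ} {v : V} (hv : v ∈ 𝒱 i) {x : Sym 𝒱} (hx : x ∈ gr 𝒱 d) :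
    ι 𝒱 v * x ∈ gr 𝒱 (i + d) :=
  SetLike.mul_mem_graded (ι_mem_gr 𝒱 hv) hx

variable (𝒱) in
/-- The increasing filtration of `S(V)` by word length; it vanishes in negative indices. -/
def len (m : ℤ) : Submodule K (Sym 𝒱) :=
  Submodule.span K {x | ∃ l : List (Σ j : ℤ, 𝒱 j), (l.length : ℤ) ≤ m ∧ word l = x}

theorem word_mem_len (l : List (Σ j : ℤ, 𝒱 j)) {m : ℤ} (h : (l.length : ℤ) ≤ m) :
    word l ∈ len 𝒱 m :=
  Submodule.subset_span ⟨l, h, rfl⟩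

theorem len_mono {m n : ℤ} (h : m ≤ n) : len 𝒱 m ≤ len 𝒱 n :=
  Submodule.span_mono fun _ ⟨l, hl, hx⟩ => ⟨l, hl.trans h, hx⟩

theorem len_of_neg {m : ℤ} (h : m < 0) : len 𝒱 m = ⊥ := by
  rw [len, Submodule.span_eq_bot]
  rintro _ ⟨l, hl, rfl⟩
  omega

theorem ι_mul_mem_len {i m : ℤ} {v : V} (hv : v ∈ 𝒱 i) {x : Sym 𝒱} (hx : x ∈ len 𝒱 m) :
    ι 𝒱 v * x ∈ len 𝒱 (1 + m) := by
  induction hx using Submodule.span_induction with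
  | mem x h =>
    obtain ⟨l, hl, rfl⟩ := h
    rw [← word_cons ⟨i, v, hv⟩ l]
    exact word_mem_len _ (by simp; omega)
  | zero => simp
  | add x y _ _ hx hy => rw [mul_add]; exact add_mem hx hy
  | smul c x _ hx => rw [mul_smul_comm]; exact Submodule.smul_mem _ _ hx

theorem mul_mem_len {m n : ℤ} {x y : Sym 𝒱} (hx : x ∈ len 𝒱 m) (hy : y ∈ len 𝒱 n) :
    x * y ∈ len 𝒱 (m + n) := by
  have h := Submodule.mul_mem_mul hx hy
  rw [len, len, Submodule.span_mul_span] at h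
  refine Submodule.span_mono ?_ h
  rintro _ ⟨_, ⟨l, hl, rfl⟩, _, ⟨l', hl', rfl⟩, rfl⟩
  exact ⟨l ++ l', by simp; omega, by simp [word]⟩

variable [DirectSum.Decomposition 𝒱]

theorem mem_of_homogeneous {V : Type*} [AddCommGroup V] [Module K V]
    (𝒱 : ℤ → Submodule K V) [DirectSum.Decomposition 𝒱] {p : Submodule K V}
    (h : ∀ i, 𝒱 i ≤ p) (x : V) : x ∈ p := by
  have h1 : ⨆ i, 𝒱 i ≤ p := iSup_le h
  rw [(DirectSum.Decomposition.isInternal 𝒱).submodule_iSup_eq_top] at h1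
  exact h1 trivial

theorem mem_of_word {p : Submodule K (Sym 𝒱)} (h : ∀ l, word l ∈ p) (x : Sym 𝒱) : x ∈ p := by
  refine mem_of_homogeneous (gr 𝒱) (fun d => ?_) x
  rw [gr_eq_span, Submodule.span_le]
  rintro _ ⟨l, -, rfl⟩
  exact h l

/-- A subspace of `S(V)` is everything if it contains `1` and is stable under multiplication
by generators from the left. -/
theorem mem_of_ι_mul {p : Submodule K (Sym 𝒱)} (h1 : 1 ∈ p)
    (h : ∀ (i : ℤ), ∀ v ∈ 𝒱 i, ∀ x ∈ p, ι 𝒱 v * x ∈ p) (x : Sym 𝒱) : x ∈ p := by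
  refine mem_of_word (fun l => ?_) x
  induction l with
  | nil => exact h1
  | cons q l ih => rw [word_cons]; exact h _ _ q.2.2 _ ih

theorem hom_ext {M : Type*} [AddCommGroup M] [Module K M] {f g : Sym 𝒱 →ₗ[K] M}
    (h1 : f 1 = g 1)
    (h : ∀ (i : ℤ), ∀ v ∈ 𝒱 i, ∀ x, f x = g x → f (ι 𝒱 v * x) = g (ι 𝒱 v * x)) : f = g :=
  LinearMap.ext fun x => mem_of_ι_mul (p := LinearMap.eqLocus f g) h1 h x

/-- Linear maps on `S(V) ⊗ S(V)` agree if they agree on tensors with homogeneous left factor. -/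
theorem tensor_ext {M : Type*} [AddCommGroup M] [Module K M] {f g : Sym 𝒱 ⊗[K] Sym 𝒱 →ₗ[K] M}
    (h : ∀ j, ∀ a ∈ gr 𝒱 j, ∀ b, f (a ⊗ₜ b) = g (a ⊗ₜ b)) : f = g :=
  TensorProduct.ext (linearMap_ext_graded (gr 𝒱) fun j a ha => LinearMap.ext (h j a ha))

/-- Left multiplication by a generator. -/
abbrev mulι (v : V) : Sym 𝒱 →ₗ[K] Sym 𝒱 := LinearMap.mulLeft K (ι 𝒱 v)

/-- The operator `L_v ⊗ 1 + (-1)^{i|·|} ⊗ L_v` on `S(V) ⊗ S(V)`, which is the multiplication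
by `v ⊗ 1 + 1 ⊗ v` in the graded tensor product if `v` is of degree `i`. -/
def mulι₂ (i : ℤ) (v : V) : Sym 𝒱 ⊗[K] Sym 𝒱 →ₗ[K] Sym 𝒱 ⊗[K] Sym 𝒱 :=
  TensorProduct.map (mulι v) LinearMap.id + TensorProduct.map (koszul (gr 𝒱) i) (mulι v)

theorem mulι₂_tmul {i j : ℤ} {v : V} {a : Sym 𝒱} (ha : a ∈ gr 𝒱 j) (b : Sym 𝒱) :
    mulι₂ i v (a ⊗ₜ b) = (ι 𝒱 v * a) ⊗ₜ b + (-1 : ℤˣ) ^ (i * j) • (a ⊗ₜ[K] (ι 𝒱 v * b)) := by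
  simp only [mulι₂, LinearMap.add_apply, TensorProduct.map_tmul, LinearMap.mulLeft_apply,
    LinearMap.id_apply, koszul_apply _ ha]
  rw [Units.smul_def, Units.smul_def, TensorProduct.smul_tmul']

theorem comul_def (x : Sym 𝒱) : CoalgebraStruct.comul (R := K) x =
    (GradedTensorProduct.of K (gr 𝒱) (gr 𝒱)).symm (comulAlgHom 𝒱 x) := rfl

theorem comul_one : CoalgebraStruct.comul (R := K) (1 : Sym 𝒱) = 1 ⊗ₜ 1 := by
  rw [comul_def, map_one]
  rfl

theorem comulAlgHom_ι (v : V) : comulAlgHom 𝒱 (ι 𝒱 v) = comulι 𝒱 v := lift_ι _ _ v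

theorem comulι_mul {i : ℤ} {v : V} (hv : v ∈ 𝒱 i) (t : Sym 𝒱 ⊗[K] Sym 𝒱) :
    comulι 𝒱 v * GradedTensorProduct.of K (gr 𝒱) (gr 𝒱) t =
      GradedTensorProduct.of K (gr 𝒱) (gr 𝒱) (mulι₂ i v t) := by
  induction t using TensorProduct.induction_on with
  | zero => simp
  | add s t hs ht => simp only [map_add, mul_add, hs, ht]
  | tmul a b =>
    let p : Submodule K (Sym 𝒱) := LinearMap.eqLocus
      (GradedTensorProduct.mulHom (gr 𝒱) (gr 𝒱) (comulι 𝒱 v) ∘ₗ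
        (GradedTensorProduct.of K (gr 𝒱) (gr 𝒱)).toLinearMap ∘ₗ (TensorProduct.mk K _ _).flip b)
      ((GradedTensorProduct.of K (gr 𝒱) (gr 𝒱)).toLinearMap ∘ₗ mulι₂ i v ∘ₗ
        (TensorProduct.mk K _ _).flip b)
    refine mem_of_homogeneous (gr 𝒱) (p := p) (fun j a ha => ?_) a
    change comulι 𝒱 v * GradedTensorProduct.tmul K a b =
      GradedTensorProduct.of K (gr 𝒱) (gr 𝒱) (mulι₂ i v (a ⊗ₜ b))
    have h1 := GradedTensorProduct.tmul_one_mul_coe_tmul (R := K) (gr 𝒱) (gr 𝒱) (ι 𝒱 v) ⟨a, ha⟩ b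
    have h2 := GradedTensorProduct.tmul_coe_mul_coe_tmul (R := K) (gr 𝒱) (gr 𝒱) 1
      ⟨_, ι_mem_gr 𝒱 hv⟩ ⟨a, ha⟩ b
    rw [one_mul] at h2
    rw [mulι₂_tmul ha, map_add, map_intUnits_smul]
    simp only [comulι, LinearMap.add_apply, LinearMap.comp_apply, AlgHom.toLinearMap_apply,
      GradedTensorProduct.includeLeft_apply, GradedTensorProduct.includeRight_apply, add_mul]
    rw [h1, h2]

theorem comul_ι_mul {i : ℤ} {v : V} (hv : v ∈ 𝒱 i) (x : Sym 𝒱) :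
    CoalgebraStruct.comul (R := K) (ι 𝒱 v * x) = mulι₂ i v (CoalgebraStruct.comul (R := K) x) := by
  rw [comul_def, comul_def, map_mul, comulAlgHom_ι]
  exact comulι_mul hv _

theorem counit_one : CoalgebraStruct.counit (R := K) (1 : Sym 𝒱) = 1 :=
  map_one (lift (𝒱 := 𝒱) (0 : V →ₗ[K] K) _)

theorem counit_ι_mul (v : V) (x : Sym 𝒱) : CoalgebraStruct.counit (R := K) (ι 𝒱 v * x) = 0 := by
  change lift (𝒱 := 𝒱) (0 : V →ₗ[K] K) _ (ι 𝒱 v * x) = 0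
  rw [map_mul, lift_ι, LinearMap.zero_apply, zero_mul]

/-- The counit vanishes on elements of nonzero degree. -/
theorem counit_of_mem_gr {d : ℤ} (hd : d ≠ 0) {x : Sym 𝒱} (hx : x ∈ gr 𝒱 d) :
    CoalgebraStruct.counit (R := K) x = 0 := by
  suffices gr 𝒱 d ≤ LinearMap.ker (CoalgebraStruct.counit (R := K) (A := Sym 𝒱)) from this hx
  rw [gr_eq_span, Submodule.span_le]
  rintro _ ⟨l, hl, rfl⟩
  cases l with
  | nil => exact absurd hl.symm hd
  | cons p l => rw [word_cons]; exact counit_ι_mul _ _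

/-! ### Compatibility of the comultiplication with gradings and filtrations -/

/-- The subspace `∑_{i+j=d} U_i ⊗ U_j`. -/
def tensorSum {C : Type*} [AddCommGroup C] [Module K C] (U : ℤ → Submodule K C) (d : ℤ) :
    Submodule K (C ⊗[K] C) :=
  Submodule.span K {t | ∃ i j : ℤ, i + j = d ∧ ∃ a ∈ U i, ∃ b ∈ U j, a ⊗ₜ b = t}

theorem mulι₂_mem_tensorSum {U : ℤ → Submodule K (Sym 𝒱)} {i r d : ℤ} {v : V}
    (hU : ∀ e, ∀ x ∈ U e, ι 𝒱 v * x ∈ U (r + e)) (hU' : ∀ e, ∀ x ∈ U e, koszul (gr 𝒱) i x ∈ U e)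
    {t : Sym 𝒱 ⊗[K] Sym 𝒱} (ht : t ∈ tensorSum U d) : mulι₂ i v t ∈ tensorSum U (r + d) := by
  suffices tensorSum U d ≤ (tensorSum U (r + d)).comap (mulι₂ i v) from this ht
  rw [tensorSum, Submodule.span_le]
  rintro _ ⟨e, e', rfl, a, ha, b, hb, rfl⟩
  simp only [Submodule.comap_coe, Set.mem_preimage, SetLike.mem_coe, mulι₂, LinearMap.add_apply,
    TensorProduct.map_tmul, LinearMap.mulLeft_apply, LinearMap.id_apply]
  exact add_mem (Submodule.subset_span ⟨r + e, e', by ring, _, hU e a ha, _, hb, rfl⟩)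
    (Submodule.subset_span ⟨e, r + e', by ring, _, hU' e a ha, _, hU e' b hb, rfl⟩)

theorem comul_mem_tensorSum_gr {d : ℤ} {x : Sym 𝒱} (hx : x ∈ gr 𝒱 d) :
    CoalgebraStruct.comul (R := K) x ∈ tensorSum (gr 𝒱) d := by
  suffices gr 𝒱 d ≤ (tensorSum (gr 𝒱) d).comap (CoalgebraStruct.comul (R := K)) from this hx
  rw [gr_eq_span, Submodule.span_le]
  rintro _ ⟨l, rfl, rfl⟩
  simp only [Submodule.comap_coe, Set.mem_preimage, SetLike.mem_coe]
  clear hx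
  induction l with
  | nil =>
    rw [word_nil, comul_one]
    exact Submodule.subset_span ⟨0, 0, by simp, 1, one_mem_gr, 1, one_mem_gr, rfl⟩
  | cons p l ih =>
    rw [word_cons, comul_ι_mul p.2.2, List.map_cons, List.sum_cons]
    exact mulι₂_mem_tensorSum (fun e x hx => ι_mul_mem_gr p.2.2 hx)
      (fun e x hx => koszul_mem _ hx) ih

theorem koszul_mem_len {i m : ℤ} {x : Sym 𝒱} (hx : x ∈ len 𝒱 m) :
    koszul (gr 𝒱) i x ∈ len 𝒱 m := by
  suffices len 𝒱 m ≤ (len 𝒱 m).comap (koszul (gr 𝒱) i) from this hx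
  rw [len, Submodule.span_le]
  rintro _ ⟨l, hl, rfl⟩
  simp only [Submodule.comap_coe, Set.mem_preimage, SetLike.mem_coe]
  rw [koszul_apply _ (word_mem_gr l), Units.smul_def]
  exact zsmul_mem (word_mem_len l hl) _

theorem tensorSum_mono {C : Type*} [AddCommGroup C] [Module K C] {U : ℤ → Submodule K C}
    (hU : Monotone U) : Monotone (tensorSum U) := by
  intro d e h
  refine Submodule.span_le.2 ?_
  rintro _ ⟨i, j, rfl, a, ha, b, hb, rfl⟩
  exact Submodule.subset_span ⟨i, e - i, by ring, a, ha, b, hU (by omega) hb, rfl⟩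

theorem comul_mem_tensorSum_len {m : ℤ} {x : Sym 𝒱} (hx : x ∈ len 𝒱 m) :
    CoalgebraStruct.comul (R := K) x ∈ tensorSum (len 𝒱) m := by
  suffices len 𝒱 m ≤ (tensorSum (len 𝒱) m).comap (CoalgebraStruct.comul (R := K)) from this hx
  rw [len, Submodule.span_le]
  rintro _ ⟨l, hl, rfl⟩
  simp only [Submodule.comap_coe, Set.mem_preimage, SetLike.mem_coe]
  refine tensorSum_mono (fun _ _ => len_mono) hl ?_
  clear hl
  induction l with
  | nil =>
    rw [word_nil, comul_one]
    exact Submodule.subset_span ⟨0, 0, by simp, 1, word_mem_len [] (by simp), 1,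
      word_mem_len [] (by simp), rfl⟩
  | cons p l ih =>
    rw [word_cons, comul_ι_mul p.2.2, List.length_cons, Nat.cast_succ, add_comm]
    exact mulι₂_mem_tensorSum (fun e x hx => ι_mul_mem_len p.2.2 hx)
      (fun e x hx => koszul_mem_len hx) ih

/-- The comultiplication has degree zero, hence commutes with the Koszul signs. -/
theorem comul_koszul (i : ℤ) : CoalgebraStruct.comul (R := K) ∘ₗ koszul (gr 𝒱) i =
    TensorProduct.map (koszul (gr 𝒱) i) (koszul (gr 𝒱) i) ∘ₗ CoalgebraStruct.comul := by
  refine linearMap_ext_graded (gr 𝒱) fun d x hx => ?_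
  rw [LinearMap.comp_apply, LinearMap.comp_apply, koszul_apply _ hx, map_intUnits_smul]
  suffices ∀ t ∈ tensorSum (gr 𝒱) d, (-1 : ℤˣ) ^ (i * d) • t =
      TensorProduct.map (koszul (gr 𝒱) i) (koszul (gr 𝒱) i) t from
    this _ (comul_mem_tensorSum_gr hx)
  intro t ht
  induction ht using Submodule.span_induction with
  | mem t h =>
    obtain ⟨j, k, rfl, a, ha, b, hb, rfl⟩ := h
    rw [TensorProduct.map_tmul, koszul_apply _ ha, koszul_apply _ hb, mul_add, uzpow_add, mul_smul]
    simp only [Units.smul_def, TensorProduct.smul_tmul', TensorProduct.tmul_smul]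
    rw [smul_comm]
  | zero => simp
  | add s t _ _ hs ht => rw [smul_add, hs, ht, map_add]
  | smul c t _ ht => rw [smul_comm, ht, map_smul]

theorem counit_koszul (i : ℤ) : CoalgebraStruct.counit (R := K) ∘ₗ koszul (gr 𝒱) i =
    CoalgebraStruct.counit (R := K) := by
  refine linearMap_ext_graded (gr 𝒱) fun d x hx => ?_
  rw [LinearMap.comp_apply, koszul_apply _ hx]
  rcases eq_or_ne d 0 with rfl | hd
  · rw [mul_zero, uzpow_zero, one_smul]
  · rw [map_intUnits_smul, counit_of_mem_gr hd hx, smul_zero]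

theorem comul_comp_mulι {i : ℤ} {v : V} (hv : v ∈ 𝒱 i) :
    CoalgebraStruct.comul (R := K) ∘ₗ mulι (𝒱 := 𝒱) v = mulι₂ i v ∘ₗ CoalgebraStruct.comul :=
  LinearMap.ext fun x => comul_ι_mul hv x

theorem counit_comp_mulι (v : V) :
    CoalgebraStruct.counit (R := K) ∘ₗ mulι (𝒱 := 𝒱) v = 0 :=
  LinearMap.ext fun x => counit_ι_mul v x

/-- The coalgebra axioms are checked by induction on the length of words: both sides intertwine
the multiplication by a generator with the same operator. -/
instance instCoalgebra : Coalgebra K (Sym 𝒱) where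
  coassoc := by
    refine hom_ext ?_ fun i v hv x hx => ?_
    · simp [comul_one]
    · set δ := CoalgebraStruct.comul (R := K) (A := Sym 𝒱)
      set κ := koszul (gr 𝒱) i
      have hl : (TensorProduct.assoc K (Sym 𝒱) (Sym 𝒱) (Sym 𝒱)).toLinearMap ∘ₗ
          δ.rTensor (Sym 𝒱) ∘ₗ mulι₂ i v =
          (TensorProduct.map (mulι v) (TensorProduct.map LinearMap.id LinearMap.id) +
            TensorProduct.map κ (mulι₂ i v)) ∘ₗ
            (TensorProduct.assoc K (Sym 𝒱) (Sym 𝒱) (Sym 𝒱)).toLinearMap ∘ₗ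
              δ.rTensor (Sym 𝒱) := by
        have h1 : δ.rTensor (Sym 𝒱) ∘ₗ mulι₂ i v =
            (TensorProduct.map (TensorProduct.map (mulι v) LinearMap.id) LinearMap.id +
              TensorProduct.map (TensorProduct.map κ (mulι v)) LinearMap.id +
              TensorProduct.map (TensorProduct.map κ κ) (mulι v)) ∘ₗ δ.rTensor (Sym 𝒱) := by
          rw [LinearMap.rTensor, mulι₂, LinearMap.comp_add, ← TensorProduct.map_comp,
            ← TensorProduct.map_comp, comul_comp_mulι hv, comul_koszul, LinearMap.add_comp,
            LinearMap.add_comp, ← TensorProduct.map_comp, ← TensorProduct.map_comp,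
            ← TensorProduct.map_comp, mulι₂, LinearMap.add_comp, TensorProduct.map_add_left]
          simp only [LinearMap.comp_id, LinearMap.id_comp]
          rfl
        rw [h1, ← LinearMap.comp_assoc, LinearMap.comp_add, LinearMap.comp_add]
        simp only [← TensorProduct.map_map_comp_assoc_eq]
        rw [← LinearMap.add_comp, ← LinearMap.add_comp, LinearMap.comp_assoc, add_assoc,
          ← TensorProduct.map_add_right]
        rfl
      have hr : δ.lTensor (Sym 𝒱) ∘ₗ mulι₂ i v =
          (TensorProduct.map (mulι v) (TensorProduct.map LinearMap.id LinearMap.id) +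
            TensorProduct.map κ (mulι₂ i v)) ∘ₗ δ.lTensor (Sym 𝒱) := by
        rw [LinearMap.lTensor, mulι₂, LinearMap.comp_add, ← TensorProduct.map_comp,
          ← TensorProduct.map_comp, comul_comp_mulι hv, LinearMap.add_comp,
          ← TensorProduct.map_comp, ← TensorProduct.map_comp, TensorProduct.map_id]
        simp only [LinearMap.comp_id, LinearMap.id_comp]
        rfl
      simp only [LinearMap.comp_apply] at hx ⊢
      have e1 : δ (ι 𝒱 v * x) = mulι₂ i v (δ x) := comul_ι_mul hv x
      rw [e1]
      have h1 := LinearMap.congr_fun hl (δ x)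
      have h2 := LinearMap.congr_fun hr (δ x)
      simp only [LinearMap.comp_apply] at h1 h2
      rw [h1, h2, hx]
  rTensor_counit_comp_comul := by
    refine hom_ext ?_ fun i v hv x hx => ?_
    · simp [comul_one, counit_one]
    · have h : (CoalgebraStruct.counit (R := K) (A := Sym 𝒱)).rTensor (Sym 𝒱) ∘ₗ mulι₂ i v =
          (mulι v).lTensor K ∘ₗ (CoalgebraStruct.counit (R := K) (A := Sym 𝒱)).rTensor (Sym 𝒱) := by
        rw [LinearMap.rTensor, mulι₂, LinearMap.comp_add, ← TensorProduct.map_comp,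
          ← TensorProduct.map_comp, counit_comp_mulι, counit_koszul, TensorProduct.map_zero_left,
          zero_add, LinearMap.lTensor, ← TensorProduct.map_comp]
        rfl
      have h1 := LinearMap.congr_fun h (CoalgebraStruct.comul x)
      simp only [LinearMap.comp_apply] at hx h1 ⊢
      rw [comul_ι_mul hv, h1, hx]
      rfl
  lTensor_counit_comp_comul := by
    refine hom_ext ?_ fun i v hv x hx => ?_
    · simp [comul_one, counit_one]
    · have h : (CoalgebraStruct.counit (R := K) (A := Sym 𝒱)).lTensor (Sym 𝒱) ∘ₗ mulι₂ i v =
          (mulι v).rTensor K ∘ₗ (CoalgebraStruct.counit (R := K) (A := Sym 𝒱)).lTensor (Sym 𝒱) := by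
        rw [LinearMap.lTensor, mulι₂, LinearMap.comp_add, ← TensorProduct.map_comp,
          ← TensorProduct.map_comp, counit_comp_mulι, TensorProduct.map_zero_right,
          add_zero, LinearMap.rTensor, ← TensorProduct.map_comp]
        rfl
      have h1 := LinearMap.congr_fun h (CoalgebraStruct.comul x)
      simp only [LinearMap.comp_apply] at hx h1 ⊢
      rw [comul_ι_mul hv, h1, hx]
      rfl

end Sym

namespace Sym

variable {K : Type*} [Field K] {V : Type*} [AddCommGroup V] [Module K V]
  {𝒱 : ℤ → Submodule K V} [DirectSum.Decomposition 𝒱]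
  {A : Type*} [Ring A] [Algebra K A] {B : Type*} [Ring B] [Algebra K B]

/-! ### The convolution algebra of linear maps out of `S(V)` -/

open WithConv

variable (𝒱) in
/-- The span of the symmetrized tensors in `S(V) ⊗ S(V)`, where the flip carries the Koszul
sign. -/
def symTensor : Submodule K (Sym 𝒱 ⊗[K] Sym 𝒱) :=
  Submodule.span K {t | ∃ i j : ℤ, ∃ a ∈ gr 𝒱 i, ∃ b ∈ gr 𝒱 j,
    a ⊗ₜ b + (-1 : ℤˣ) ^ (i * j) • b ⊗ₜ[K] a = t}

/-- `S(V)` is cocommutative in the graded sense. -/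
theorem comul_mem_symTensor [CharZero K] (x : Sym 𝒱) :
    CoalgebraStruct.comul (R := K) x ∈ symTensor 𝒱 := by
  refine mem_of_ι_mul (p := (symTensor 𝒱).comap (CoalgebraStruct.comul (R := K))) ?_ ?_ x
  · rw [Submodule.mem_comap, comul_one]
    have h : (1 : Sym 𝒱) ⊗ₜ[K] (1 : Sym 𝒱) = (2 : K)⁻¹ •
        (1 ⊗ₜ 1 + (-1 : ℤˣ) ^ (0 * 0 : ℤ) • (1 : Sym 𝒱) ⊗ₜ[K] (1 : Sym 𝒱)) := by
      rw [mul_zero, uzpow_zero, one_smul, ← two_smul K, smul_smul, inv_mul_cancel₀ two_ne_zero,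
        one_smul]
    rw [h]
    exact Submodule.smul_mem _ _ (Submodule.subset_span ⟨0, 0, 1, one_mem_gr, 1, one_mem_gr, rfl⟩)
  · intro k v hv x hx
    rw [Submodule.mem_comap] at hx ⊢
    rw [comul_ι_mul hv]
    generalize CoalgebraStruct.comul (R := K) x = t at hx ⊢
    induction hx using Submodule.span_induction with
    | mem t h =>
      obtain ⟨i, j, a, ha, b, hb, rfl⟩ := h
      rw [map_add, map_intUnits_smul, mulι₂_tmul ha, mulι₂_tmul hb]
      have h1 : (ι 𝒱 v * a) ⊗ₜ[K] b + (-1 : ℤˣ) ^ ((k + i) * j) • (b ⊗ₜ[K] (ι 𝒱 v * a)) ∈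
          symTensor 𝒱 :=
        Submodule.subset_span ⟨_, _, _, ι_mul_mem_gr hv ha, _, hb, rfl⟩
      have h2 : a ⊗ₜ[K] (ι 𝒱 v * b) + (-1 : ℤˣ) ^ (i * (k + j)) • ((ι 𝒱 v * b) ⊗ₜ[K] a) ∈
          symTensor 𝒱 :=
        Submodule.subset_span ⟨_, _, _, ha, _, ι_mul_mem_gr hv hb, rfl⟩
      convert! add_mem h1 (zsmul_mem h2 (((-1 : ℤˣ) ^ (k * i) : ℤˣ) : ℤ)) using 1
      have hs : (-1 : ℤˣ) ^ (k * i) * (-1 : ℤˣ) ^ (i * (k + j)) = (-1 : ℤˣ) ^ (i * j) := by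
        rw [mul_add, uzpow_add, mul_comm i k, ← mul_assoc, Int.units_mul_self, one_mul]
      have hs' : (-1 : ℤˣ) ^ (i * j) * (-1 : ℤˣ) ^ (k * j) = (-1 : ℤˣ) ^ ((k + i) * j) := by
        rw [← uzpow_add, add_mul, add_comm]
      rw [← Units.smul_def, smul_add, smul_add, smul_smul, smul_smul, hs, hs']
      abel
    | zero => simp
    | add s t _ _ hs ht => rw [map_add]; exact add_mem hs ht
    | smul c t _ ht => rw [map_smul]; exact Submodule.smul_mem _ _ ht

theorem conv_apply (a b : WithConv (Sym 𝒱 →ₗ[K] A)) (x : Sym 𝒱) :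
    (a * b) x = LinearMap.mul' K A (TensorProduct.map a.ofConv b.ofConv
      (CoalgebraStruct.comul (R := K) x)) := rfl

theorem conv_apply_eq {a b : WithConv (Sym 𝒱 →ₗ[K] A)} (f : Sym 𝒱 ⊗[K] Sym 𝒱 →ₗ[K] A)
    (h : ∀ x y, a x * b y = f (x ⊗ₜ y)) (x : Sym 𝒱) :
    (a * b) x = f (CoalgebraStruct.comul (R := K) x) := by
  rw [conv_apply]
  exact LinearMap.congr_fun (f := LinearMap.mul' K A ∘ₗ TensorProduct.map a.ofConv b.ofConv)
    (TensorProduct.ext' h) _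

/-- Maps whose values commute in the graded sense commute for the convolution product. -/
theorem conv_commute [CharZero K] {a b : WithConv (Sym 𝒱 →ₗ[K] A)}
    (h : ∀ i j : ℤ, ∀ x ∈ gr 𝒱 i, ∀ y ∈ gr 𝒱 j, a x * b y = (-1 : ℤˣ) ^ (i * j) • (b y * a x)) :
    Commute a b := by
  refine WithConv.ext (LinearMap.ext fun x => ?_)
  change (a * b) x = (b * a) x
  rw [conv_apply, conv_apply]
  have ht := comul_mem_symTensor x
  generalize CoalgebraStruct.comul (R := K) x = t at ht ⊢
  induction ht using Submodule.span_induction with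
  | mem t ht =>
    obtain ⟨i, j, x, hx, y, hy, rfl⟩ := ht
    simp only [map_add, map_intUnits_smul, TensorProduct.map_tmul, LinearMap.mul'_apply]
    rw [h i j x hx y hy, h j i y hy x hx, smul_smul, mul_comm j i, Int.units_mul_self, one_smul,
      add_comm]
  | zero => simp
  | add s t _ _ hs ht => simp only [map_add, hs, ht]
  | smul c t _ ht => simp only [map_smul, ht]

/-- The convolution product is compatible with filtrations. -/
theorem conv_mem {U : ℤ → Submodule K (Sym 𝒱)} {T : ℤ → Submodule K A} {r s : ℤ}
    (hU : ∀ d, ∀ x ∈ U d, CoalgebraStruct.comul (R := K) x ∈ tensorSum U d)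
    (hT : ∀ i j, ∀ x ∈ T i, ∀ y ∈ T j, x * y ∈ T (i + j))
    {a b : WithConv (Sym 𝒱 →ₗ[K] A)} (ha : ∀ d, ∀ x ∈ U d, a x ∈ T (d - r))
    (hb : ∀ d, ∀ x ∈ U d, b x ∈ T (d - s)) (d : ℤ) (x : Sym 𝒱) (hx : x ∈ U d) :
    (a * b) x ∈ T (d - (r + s)) := by
  rw [conv_apply]
  suffices tensorSum U d ≤ (T (d - (r + s))).comap
    (LinearMap.mul' K A ∘ₗ TensorProduct.map a.ofConv b.ofConv) from this (hU d x hx)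
  refine Submodule.span_le.2 ?_
  rintro _ ⟨i, j, rfl, x, hx, y, hy, rfl⟩
  have h := hT _ _ _ (ha i x hx) _ (hb j y hy)
  rwa [show i - r + (j - s) = i + j - (r + s) by ring] at h

/-- Composition with an algebra morphism is a morphism of convolution algebras. -/
def postcomp (g : A →ₐ[K] B) : WithConv (Sym 𝒱 →ₗ[K] A) →ₐ[K] WithConv (Sym 𝒱 →ₗ[K] B) :=
  AlgHom.ofLinearMap
    { toFun := fun f => toConv (g.toLinearMap ∘ₗ f.ofConv)
      map_add' := fun f f' => by ext; simp
      map_smul' := fun c f => by ext; simp }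
    (by ext x; simp)
    (fun f f' => by
      refine WithConv.ext ?_
      exact LinearMap.algHom_comp_convMul_distrib g f f')

theorem postcomp_apply (g : A →ₐ[K] B) (f : WithConv (Sym 𝒱 →ₗ[K] A)) (x : Sym 𝒱) :
    postcomp g f x = g (f x) := rfl

/-- Composition with a coalgebra morphism is a morphism of convolution algebras. -/
def precomp {W : Type*} [AddCommGroup W] [Module K W] {𝒲 : ℤ → Submodule K W}
    [DirectSum.Decomposition 𝒲] (F : Sym 𝒱 →ₗc[K] Sym 𝒲) :
    WithConv (Sym 𝒲 →ₗ[K] A) →ₐ[K] WithConv (Sym 𝒱 →ₗ[K] A) :=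
  AlgHom.ofLinearMap
    { toFun := fun f => toConv (f.ofConv ∘ₗ F.toLinearMap)
      map_add' := fun f f' => by ext; simp
      map_smul' := fun c f => by ext; simp }
    (by ext x; simp)
    (fun f f' => by
      refine WithConv.ext ?_
      exact LinearMap.convMul_comp_coalgHom_distrib f f' F)

theorem precomp_apply {W : Type*} [AddCommGroup W] [Module K W] {𝒲 : ℤ → Submodule K W}
    [DirectSum.Decomposition 𝒲] (F : Sym 𝒱 →ₗc[K] Sym 𝒲) (f : WithConv (Sym 𝒲 →ₗ[K] A))
    (x : Sym 𝒱) : precomp F f x = f (F x) := rfl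

/-! ### The exponential for the convolution product -/

variable (𝒱 A) in
/-- The linear maps that vanish on elements of degree less than `N`. -/
def vanishBelow (N : ℤ) : Submodule K (WithConv (Sym 𝒱 →ₗ[K] A)) where
  carrier := {f | ∀ d < N, ∀ x ∈ gr 𝒱 d, f x = 0}
  add_mem' := fun hf hg d hd x hx => by
    simp [hf d hd x hx, hg d hd x hx]
  zero_mem' := fun d hd x hx => by simp
  smul_mem' := fun c f hf d hd x hx => by simp [hf d hd x hx]

omit [DirectSum.Decomposition 𝒱] in
theorem vanishBelow_anti {M N : ℤ} (h : M ≤ N) : vanishBelow 𝒱 A N ≤ vanishBelow 𝒱 A M :=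
  fun _ hf d hd => hf d (hd.trans_le h)

theorem mul_mem_vanishBelow {M N : ℤ} {a b : WithConv (Sym 𝒱 →ₗ[K] A)}
    (ha : a ∈ vanishBelow 𝒱 A M) (hb : b ∈ vanishBelow 𝒱 A N) :
    a * b ∈ vanishBelow 𝒱 A (M + N) := by
  intro d hd x hx
  rw [conv_apply]
  suffices tensorSum (gr 𝒱) d ≤ LinearMap.ker
    (LinearMap.mul' K A ∘ₗ TensorProduct.map a.ofConv b.ofConv) from
    this (comul_mem_tensorSum_gr hx)
  refine Submodule.span_le.2 ?_
  rintro _ ⟨i, j, rfl, x, hx, y, hy, rfl⟩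
  rw [SetLike.mem_coe, LinearMap.mem_ker, LinearMap.comp_apply, TensorProduct.map_tmul,
    LinearMap.mul'_apply]
  rcases lt_or_ge i M with hi | hi
  · rw [ha i hi x hx, zero_mul]
  · rw [hb j (by omega) y hy, mul_zero]

theorem one_mem_vanishBelow : (1 : WithConv (Sym 𝒱 →ₗ[K] A)) ∈ vanishBelow 𝒱 A 0 := by
  intro d hd x hx
  rw [LinearMap.convOne_apply, counit_of_mem_gr hd.ne hx, map_zero]

theorem pow_mem_vanishBelow {h : WithConv (Sym 𝒱 →ₗ[K] A)} (hh : h ∈ vanishBelow 𝒱 A 1) (n : ℕ) :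
    h ^ n ∈ vanishBelow 𝒱 A n := by
  induction n with
  | zero => simpa using one_mem_vanishBelow
  | succ n ih => rw [pow_succ, Nat.cast_succ]; exact mul_mem_vanishBelow ih hh

theorem eq_of_sub_mem_vanishBelow {a b : WithConv (Sym 𝒱 →ₗ[K] A)}
    (h : ∀ N : ℕ, a - b ∈ vanishBelow 𝒱 A N) : a = b := by
  refine WithConv.ext (linearMap_ext_graded (gr 𝒱) fun d x hx => ?_)
  exact sub_eq_zero.1 (h (d.toNat + 1) d (by omega) x hx)

/-- The divided power `hⁿ / n!` for the convolution product. -/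
def divPow (n : ℕ) (h : WithConv (Sym 𝒱 →ₗ[K] A)) : WithConv (Sym 𝒱 →ₗ[K] A) :=
  (n.factorial : K)⁻¹ • h ^ n

theorem divPow_zero (h : WithConv (Sym 𝒱 →ₗ[K] A)) : divPow 0 h = 1 := by simp [divPow]

theorem divPow_mem_vanishBelow {h : WithConv (Sym 𝒱 →ₗ[K] A)} (hh : h ∈ vanishBelow 𝒱 A 1)
    (n : ℕ) : divPow n h ∈ vanishBelow 𝒱 A n :=
  Submodule.smul_mem _ _ (pow_mem_vanishBelow hh n)

theorem divPow_add [CharZero K] {a b : WithConv (Sym 𝒱 →ₗ[K] A)} (hab : Commute a b) (n : ℕ) :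
    divPow n (a + b) = ∑ m ∈ Finset.HasAntidiagonal.antidiagonal n, divPow m.1 a * divPow m.2 b := by
  rw [divPow, hab.add_pow', Finset.smul_sum]
  refine Finset.sum_congr rfl fun m hm => ?_
  rw [Finset.HasAntidiagonal.mem_antidiagonal] at hm
  subst hm
  rw [divPow, divPow, smul_mul_smul_comm, ← Nat.cast_smul_eq_nsmul K, smul_smul]
  congr 1
  have h1 := Nat.add_choose_mul_factorial_mul_factorial m.1 m.2
  rw [← Nat.choose_symm_add] at h1
  have h2 : ((m.1 + m.2).factorial : K) ≠ 0 := by exact_mod_cast Nat.factorial_ne_zero _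
  have h3 : (m.1.factorial : K) ≠ 0 := by exact_mod_cast Nat.factorial_ne_zero _
  have h4 : (m.2.factorial : K) ≠ 0 := by exact_mod_cast Nat.factorial_ne_zero _
  field_simp
  exact_mod_cast h1

/-- The exponential `∑ hⁿ / n!` for the convolution product. It is meaningful for maps `h` that
vanish in degrees `≤ 0`, as then `hⁿ` vanishes in degrees `< n`; the sum is cut off accordingly. -/
def convExp (h : WithConv (Sym 𝒱 →ₗ[K] A)) : WithConv (Sym 𝒱 →ₗ[K] A) :=
  toConv (gradedMap (gr 𝒱) fun d => ∑ n ∈ Finset.range (d.toNat + 1), (divPow n h).ofConv)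

theorem convExp_apply {h : WithConv (Sym 𝒱 →ₗ[K] A)} (hh : h ∈ vanishBelow 𝒱 A 1) {d : ℤ} {N : ℕ}
    (hN : d < N) {x : Sym 𝒱} (hx : x ∈ gr 𝒱 d) :
    convExp h x = ∑ n ∈ Finset.range N, divPow n h x := by
  have key : ∀ M M' : ℕ, d < M → M ≤ M' →
      ∑ n ∈ Finset.range M, divPow n h x = ∑ n ∈ Finset.range M', divPow n h x := by
    intro M M' hM hM'
    refine Finset.sum_subset (Finset.range_mono hM') fun n _ hn => ?_
    rw [Finset.mem_range, not_lt] at hn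
    exact divPow_mem_vanishBelow hh n d (by omega) x hx
  have h1 : convExp h x = ∑ n ∈ Finset.range (d.toNat + 1), divPow n h x := by
    rw [convExp, gradedMap_apply _ _ hx, LinearMap.sum_apply]
  rw [h1]
  rcases le_total (d.toNat + 1) N with h2 | h2
  · exact key _ _ (by omega) h2
  · exact (key _ _ hN h2).symm

omit [DirectSum.Decomposition 𝒱] in
theorem ofConv_sum {ι : Type*} (s : Finset ι) (f : ι → WithConv (Sym 𝒱 →ₗ[K] A)) (x : Sym 𝒱) :
    (∑ i ∈ s, f i) x = ∑ i ∈ s, f i x := by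
  induction s using Finset.cons_induction with
  | empty => simp
  | cons i s hi ih => rw [Finset.sum_cons, Finset.sum_cons, ← ih]; rfl

theorem convExp_sub_mem {h : WithConv (Sym 𝒱 →ₗ[K] A)} (hh : h ∈ vanishBelow 𝒱 A 1) (N : ℕ) :
    convExp h - ∑ n ∈ Finset.range N, divPow n h ∈ vanishBelow 𝒱 A N := by
  intro d hd x hx
  rw [ofConv_sub, LinearMap.sub_apply, ofConv_sum, convExp_apply hh hd hx, sub_self]

theorem convExp_mem {h : WithConv (Sym 𝒱 →ₗ[K] A)} (hh : h ∈ vanishBelow 𝒱 A 1) :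
    convExp h ∈ vanishBelow 𝒱 A 0 := by
  simpa using convExp_sub_mem hh 0

theorem convExp_add [CharZero K] {a b : WithConv (Sym 𝒱 →ₗ[K] A)} (hab : Commute a b)
    (ha : a ∈ vanishBelow 𝒱 A 1) (hb : b ∈ vanishBelow 𝒱 A 1) :
    convExp (a + b) = convExp a * convExp b := by
  refine eq_of_sub_mem_vanishBelow fun N => ?_
  set a' := ∑ n ∈ Finset.range N, divPow n a
  set b' := ∑ n ∈ Finset.range N, divPow n b
  have ha' : a' ∈ vanishBelow 𝒱 A 0 := Submodule.sum_mem _ fun n _ =>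
    vanishBelow_anti (by omega) (divPow_mem_vanishBelow ha n)
  have h1 := convExp_sub_mem (add_mem ha hb) N
  have h2 : convExp a * convExp b - a' * b' ∈ vanishBelow 𝒱 A N := by
    have e : convExp a * convExp b - a' * b' =
        (convExp a - a') * convExp b + a' * (convExp b - b') := by
      rw [sub_mul, mul_sub]; abel
    rw [e]
    have h3 := mul_mem_vanishBelow (convExp_sub_mem ha N) (convExp_mem hb)
    have h4 := mul_mem_vanishBelow ha' (convExp_sub_mem hb N)
    rw [add_zero] at h3
    rw [zero_add] at h4
    exact add_mem h3 h4
  -- The two truncated sums differ by products of total order at least `N`.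
  have h3 : a' * b' - ∑ n ∈ Finset.range N, divPow n (a + b) ∈ vanishBelow 𝒱 A N := by
    have e1 : a' * b' = ∑ m ∈ Finset.range N ×ˢ Finset.range N, divPow m.1 a * divPow m.2 b := by
      rw [Finset.sum_mul_sum, Finset.sum_product]
    have e2 : ∑ n ∈ Finset.range N, divPow n (a + b) =
        ∑ m ∈ Finset.range N ×ˢ Finset.range N with m.1 + m.2 < N,
          divPow m.1 a * divPow m.2 b := by
      simp_rw [divPow_add hab]
      rw [Finset.sum_sigma']
      refine Finset.sum_nbij' (fun p => p.2) (fun m => ⟨m.1 + m.2, m⟩) ?_ ?_ ?_ ?_ ?_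
      · rintro ⟨n, i, j⟩ h
        simp only [Finset.mem_sigma, Finset.mem_range, Finset.HasAntidiagonal.mem_antidiagonal] at h
        simp only [Finset.mem_filter, Finset.mem_product, Finset.mem_range]
        omega
      · rintro ⟨i, j⟩ h
        simp only [Finset.mem_filter, Finset.mem_product, Finset.mem_range] at h
        simp only [Finset.mem_sigma, Finset.mem_range, Finset.HasAntidiagonal.mem_antidiagonal]
        exact ⟨h.2, trivial⟩
      · rintro ⟨n, i, j⟩ h
        simp only [Finset.mem_sigma, Finset.mem_range, Finset.HasAntidiagonal.mem_antidiagonal] at h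
        obtain ⟨-, rfl⟩ := h
        rfl
      · rintro ⟨i, j⟩ h
        rfl
      · rintro ⟨n, i, j⟩ h
        rfl
    rw [e1, e2, ← Finset.sum_filter_add_sum_filter_not _ (fun m : ℕ × ℕ => m.1 + m.2 < N),
      add_sub_cancel_left]
    refine Submodule.sum_mem _ fun m hm => ?_
    have hm' := (Finset.mem_filter.1 hm).2
    exact vanishBelow_anti (by omega)
      (mul_mem_vanishBelow (divPow_mem_vanishBelow ha m.1) (divPow_mem_vanishBelow hb m.2))
  have e : convExp (a + b) - convExp a * convExp b =
      (convExp (a + b) - ∑ n ∈ Finset.range N, divPow n (a + b)) -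
        (convExp a * convExp b - a' * b') -
        (a' * b' - ∑ n ∈ Finset.range N, divPow n (a + b)) := by abel
  rw [e]
  exact sub_mem (sub_mem h1 h2) h3

theorem divPow_postcomp (g : A →ₐ[K] B) (n : ℕ) (h : WithConv (Sym 𝒱 →ₗ[K] A)) :
    divPow n (postcomp g h) = postcomp g (divPow n h) := by
  rw [divPow, divPow, map_smul, map_pow]

theorem postcomp_mem_vanishBelow (g : A →ₐ[K] B) {N : ℤ} {h : WithConv (Sym 𝒱 →ₗ[K] A)}
    (hh : h ∈ vanishBelow 𝒱 A N) : postcomp g h ∈ vanishBelow 𝒱 B N := by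
  intro d hd x hx
  rw [postcomp_apply, hh d hd x hx, map_zero]

theorem convExp_postcomp (g : A →ₐ[K] B) {h : WithConv (Sym 𝒱 →ₗ[K] A)}
    (hh : h ∈ vanishBelow 𝒱 A 1) : convExp (postcomp g h) = postcomp g (convExp h) := by
  refine WithConv.ext (linearMap_ext_graded (gr 𝒱) fun d x hx => ?_)
  change convExp (postcomp g h) x = postcomp g (convExp h) x
  have hd : d < (d.toNat + 1 : ℕ) := by omega
  rw [convExp_apply (postcomp_mem_vanishBelow g hh) hd hx, postcomp_apply, convExp_apply hh hd hx,
    map_sum]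
  simp_rw [divPow_postcomp, postcomp_apply]

theorem convExp_precomp {W : Type*} [AddCommGroup W] [Module K W] {𝒲 : ℤ → Submodule K W}
    [DirectSum.Decomposition 𝒲] (F : Sym 𝒱 →ₗc[K] Sym 𝒲)
    (hF : ∀ d, ∀ x ∈ gr 𝒱 d, F x ∈ gr 𝒲 d) {h : WithConv (Sym 𝒲 →ₗ[K] A)}
    (hh : h ∈ vanishBelow 𝒲 A 1) : convExp (precomp F h) = precomp F (convExp h) := by
  have hh' : precomp F h ∈ vanishBelow 𝒱 A 1 := fun d hd x hx => hh d hd _ (hF d x hx)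
  refine WithConv.ext (linearMap_ext_graded (gr 𝒱) fun d x hx => ?_)
  change convExp (precomp F h) x = precomp F (convExp h) x
  have hd : d < (d.toNat + 1 : ℕ) := by omega
  rw [convExp_apply hh' hd hx, precomp_apply, convExp_apply hh hd (hF d x hx)]
  refine Finset.sum_congr rfl fun n _ => ?_
  rw [divPow, divPow, ← map_pow, ← map_smul, precomp_apply]

end Sym

namespace Sym

open WithConv

variable {K : Type*} [Field K] {V : Type*} [AddCommGroup V] [Module K V]
  {𝒱 : ℤ → Submodule K V} [DirectSum.Decomposition 𝒱]
  {W : Type*} [AddCommGroup W] [Module K W]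
  {𝒲 : ℤ → Submodule K W} [DirectSum.Decomposition 𝒲]

/-! ### Coalgebra morphisms as exponentials -/

omit [DirectSum.Decomposition 𝒱] in
theorem proj_word_mem (l : List (Σ j : ℤ, 𝒱 j)) :
    proj 𝒱 (word l) ∈ 𝒱 (l.map fun p => p.1).sum := by
  match l with
  | [] => rw [word_nil, proj_one]; exact zero_mem _
  | [p] => simp [word, proj_ι]
  | p :: q :: l => rw [word_cons, word_cons, proj_ι_mul_ι_mul]; exact zero_mem _

omit [DirectSum.Decomposition 𝒱] in
theorem proj_mem {d : ℤ} {x : Sym 𝒱} (hx : x ∈ gr 𝒱 d) : proj 𝒱 x ∈ 𝒱 d := by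
  suffices gr 𝒱 d ≤ (𝒱 d).comap (proj 𝒱) from this hx
  rw [gr_eq_span, Submodule.span_le]
  rintro _ ⟨l, rfl, rfl⟩
  exact proj_word_mem l

/-- The map `S(V) → S(W)` with values in the generators given by a linear map `S(V) → W`. -/
abbrev toGen (𝒲 : ℤ → Submodule K W) (g : Sym 𝒱 →ₗ[K] W) : WithConv (Sym 𝒱 →ₗ[K] Sym 𝒲) :=
  toConv (ι 𝒲 ∘ₗ g)

omit [DirectSum.Decomposition 𝒱] [DirectSum.Decomposition 𝒲] in
theorem toGen_mem_vanishBelow (hW : ∀ i < 1, 𝒲 i = ⊥) {g : Sym 𝒱 →ₗ[K] W}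
    (hg : ∀ d, ∀ x ∈ gr 𝒱 d, g x ∈ 𝒲 d) : toGen 𝒲 g ∈ vanishBelow 𝒱 (Sym 𝒲) 1 := by
  intro d hd x hx
  have h := hg d x hx
  rw [hW d hd, Submodule.mem_bot] at h
  rw [LinearMap.comp_apply, h, map_zero]

omit [DirectSum.Decomposition 𝒲] in
theorem toGen_commute [CharZero K] {g g' : Sym 𝒱 →ₗ[K] W} (hg : ∀ d, ∀ x ∈ gr 𝒱 d, g x ∈ 𝒲 d)
    (hg' : ∀ d, ∀ x ∈ gr 𝒱 d, g' x ∈ 𝒲 d) : Commute (toGen 𝒲 g) (toGen 𝒲 g') :=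
  conv_commute fun _ _ _ hx _ hy => ι_mul_ι (hg _ _ hx) (hg' _ _ hy)

omit [DirectSum.Decomposition 𝒲] in
theorem convExp_toGen_mem_gr (hW : ∀ i < 1, 𝒲 i = ⊥) {g : Sym 𝒱 →ₗ[K] W}
    (hg : ∀ d, ∀ x ∈ gr 𝒱 d, g x ∈ 𝒲 d) {d : ℤ} {x : Sym 𝒱} (hx : x ∈ gr 𝒱 d) :
    convExp (toGen 𝒲 g) x ∈ gr 𝒲 d := by
  have hpow : ∀ n : ℕ, ∀ d, ∀ x ∈ gr 𝒱 d, (toGen 𝒲 g ^ n) x ∈ gr 𝒲 (d - 0) := by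
    intro n
    induction n with
    | zero =>
      intro d x hx
      rw [pow_zero, LinearMap.convOne_apply, sub_zero]
      rcases eq_or_ne d 0 with rfl | hd
      · rw [Algebra.algebraMap_eq_smul_one]
        exact Submodule.smul_mem _ _ one_mem_gr
      · rw [counit_of_mem_gr hd hx, map_zero]
        exact zero_mem _
    | succ n ih =>
      rw [pow_succ]
      have h := conv_mem (fun d x hx => comul_mem_tensorSum_gr hx)
        (fun i j x hx y hy => SetLike.mul_mem_graded (A := gr 𝒲) hx hy) ih
        (b := toGen 𝒲 g) (s := 0) (fun d x hx => by rw [sub_zero]; exact ι_mem_gr 𝒲 (hg d x hx))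
      simpa using h
  rw [convExp_apply (toGen_mem_vanishBelow hW hg) (N := d.toNat + 1) (by omega) hx]
  refine Submodule.sum_mem _ fun n _ => Submodule.smul_mem _ _ ?_
  simpa using hpow n d x hx

/-- The exponential of a map with values in the generators is comultiplicative: the generators are
primitive and the two inclusions `S(W) → S(W) ⊗ S(W)` commute in the graded sense, so that the
exponential law applies. -/
theorem comul_convExp_toGen [CharZero K] (hW : ∀ i < 1, 𝒲 i = ⊥) {g : Sym 𝒱 →ₗ[K] W}
    (hg : ∀ d, ∀ x ∈ gr 𝒱 d, g x ∈ 𝒲 d) (x : Sym 𝒱) :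
    CoalgebraStruct.comul (R := K) (convExp (toGen 𝒲 g) x) =
      TensorProduct.map (convExp (toGen 𝒲 g)).ofConv (convExp (toGen 𝒲 g)).ofConv
        (CoalgebraStruct.comul (R := K) x) := by
  set h := toGen 𝒲 g
  have hh : h ∈ vanishBelow 𝒱 (Sym 𝒲) 1 := toGen_mem_vanishBelow hW hg
  set iL := GradedTensorProduct.includeLeft (R := K) (gr 𝒲) (gr 𝒲)
  set iR := GradedTensorProduct.includeRight (R := K) (gr 𝒲) (gr 𝒲)
  have hsum : postcomp (comulAlgHom 𝒲) h = postcomp iL h + postcomp iR h :=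
    WithConv.ext (LinearMap.ext fun x => comulAlgHom_ι (g x))
  have hcomm : Commute (postcomp iL h) (postcomp iR h) := by
    refine conv_commute fun i j x hx y hy => ?_
    have h1 := GradedTensorProduct.tmul_one_mul_one_tmul (R := K) (gr 𝒲) (gr 𝒲)
      (ι 𝒲 (g x)) (ι 𝒲 (g y))
    have h2 := GradedTensorProduct.tmul_coe_mul_coe_tmul (R := K) (gr 𝒲) (gr 𝒲) 1
      ⟨_, ι_mem_gr 𝒲 (hg j y hy)⟩ ⟨_, ι_mem_gr 𝒲 (hg i x hx)⟩ 1
    simp only [one_mul, mul_one] at h2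
    refine h1.trans ?_
    refine Eq.trans ?_ (congrArg (fun z => (-1 : ℤˣ) ^ (i * j) • z) h2).symm
    rw [smul_smul, mul_comm j i, Int.units_mul_self, one_smul]
  have hexp : postcomp (comulAlgHom 𝒲) (convExp h) =
      postcomp iL (convExp h) * postcomp iR (convExp h) := by
    rw [← convExp_postcomp _ hh, hsum, convExp_add hcomm (postcomp_mem_vanishBelow _ hh)
      (postcomp_mem_vanishBelow _ hh), convExp_postcomp _ hh, convExp_postcomp _ hh]
  have h1 := congrArg (fun f => f.ofConv x) hexp
  have h2 := conv_apply_eq (a := postcomp iL (convExp h)) (b := postcomp iR (convExp h))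
    ((GradedTensorProduct.of K (gr 𝒲) (gr 𝒲)).toLinearMap ∘ₗ
      TensorProduct.map (convExp h).ofConv (convExp h).ofConv)
    (fun a b => GradedTensorProduct.tmul_one_mul_one_tmul (R := K) (gr 𝒲) (gr 𝒲)
        (convExp h a) (convExp h b)) x
  exact h1.trans h2

theorem counit_convExp_toGen (hW : ∀ i < 1, 𝒲 i = ⊥) {g : Sym 𝒱 →ₗ[K] W}
    (hg : ∀ d, ∀ x ∈ gr 𝒱 d, g x ∈ 𝒲 d) (x : Sym 𝒱) :
    CoalgebraStruct.counit (R := K) (convExp (toGen 𝒲 g) x) =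
      CoalgebraStruct.counit (R := K) x := by
  set ε : Sym 𝒲 →ₐ[K] K := lift (𝒱 := 𝒲) (0 : W →ₗ[K] K) (fun _ _ _ _ _ _ => by
    simp only [LinearMap.zero_apply, mul_zero, smul_zero])
  have h0 : postcomp ε (toGen 𝒲 g) = 0 :=
    WithConv.ext (LinearMap.ext fun x => lift_ι _ _ (g x))
  have h1 : postcomp ε (convExp (toGen 𝒲 g)) = 1 := by
    rw [← convExp_postcomp _ (toGen_mem_vanishBelow hW hg), h0]
    refine eq_of_sub_mem_vanishBelow fun N => ?_
    have h := convExp_sub_mem (zero_mem (vanishBelow 𝒱 K 1)) (N + 1)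
    rw [Finset.sum_range_succ'] at h
    have e : ∀ n, divPow (n + 1) (0 : WithConv (Sym 𝒱 →ₗ[K] K)) = 0 := fun n => by
      rw [divPow, zero_pow n.succ_ne_zero, smul_zero]
    simp only [e, Finset.sum_const_zero, zero_add, divPow_zero] at h
    exact vanishBelow_anti (by simp) h
  exact congrArg (fun f => f.ofConv x) h1

/-- The coalgebra morphism `S(V) → S(W)` with prescribed corestriction `g : S(V) → W`. -/
def coalgHomOf [CharZero K] (hW : ∀ i < 1, 𝒲 i = ⊥) (g : Sym 𝒱 →ₗ[K] W)
    (hg : ∀ d, ∀ x ∈ gr 𝒱 d, g x ∈ 𝒲 d) : Sym 𝒱 →ₗc[K] Sym 𝒲 where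
  toLinearMap := (convExp (toGen 𝒲 g)).ofConv
  counit_comp := LinearMap.ext fun x => counit_convExp_toGen hW hg x
  map_comp_comul := LinearMap.ext fun x => (comul_convExp_toGen hW hg x).symm

theorem toGen_proj_mul_ι {v : V} (x : Sym 𝒱) :
    toGen 𝒱 (proj 𝒱) (ι 𝒱 v * x) =
      CoalgebraStruct.counit (R := K) x • ι 𝒱 v := by
  suffices (toGen 𝒱 (proj 𝒱)).ofConv ∘ₗ mulι v =
      (CoalgebraStruct.counit (R := K) (A := Sym 𝒱)).smulRight (ι 𝒱 v) from
    LinearMap.congr_fun this x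
  refine hom_ext ?_ fun i w hw x _ => ?_
  · simp [proj_ι, counit_one]
  · simp [proj_ι_mul_ι_mul, counit_ι_mul]

/-- The convolution powers of the projection `π` to the generators satisfy
`πⁿ⁺¹ (v x) = (n + 1) v πⁿ x`, as the `n + 1` factors contribute equally. -/
theorem toGen_proj_pow_ι_mul (n : ℕ) {i : ℤ} {v : V} (hv : v ∈ 𝒱 i) (x : Sym 𝒱) :
    (toGen 𝒱 (proj 𝒱) ^ (n + 1)) (ι 𝒱 v * x) =
      (n + 1 : K) • (ι 𝒱 v * (toGen 𝒱 (proj 𝒱) ^ n) x) := by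
  set π := toGen 𝒱 (proj 𝒱)
  induction n generalizing x with
  | zero =>
    rw [zero_add, pow_one, toGen_proj_mul_ι, pow_zero, LinearMap.convOne_apply,
      Algebra.algebraMap_eq_smul_one, mul_smul_comm, mul_one, Nat.cast_zero, zero_add, one_smul]
  | succ n ih =>
    have key : LinearMap.mul' K (Sym 𝒱) ∘ₗ TensorProduct.map π.ofConv (π ^ (n + 1)).ofConv ∘ₗ
        mulι₂ i v =
        mulι v ∘ₗ (LinearMap.mul' K (Sym 𝒱) ∘ₗ TensorProduct.map
            (1 : WithConv (Sym 𝒱 →ₗ[K] Sym 𝒱)).ofConv (π ^ (n + 1)).ofConv +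
          (n + 1 : K) • LinearMap.mul' K (Sym 𝒱) ∘ₗ TensorProduct.map π.ofConv (π ^ n).ofConv) := by
      refine tensor_ext fun j a ha b => ?_
      simp only [LinearMap.comp_apply,
        LinearMap.add_apply, LinearMap.smul_apply, mulι₂_tmul ha, map_add, map_intUnits_smul,
        TensorProduct.map_tmul, LinearMap.mul'_apply, LinearMap.mulLeft_apply, ih]
      have e1 : π.ofConv (ι 𝒱 v * a) = CoalgebraStruct.counit (R := K) a • ι 𝒱 v :=
        toGen_proj_mul_ι a
      have e2 : π.ofConv a * ι 𝒱 v = (-1 : ℤˣ) ^ (j * i) • (ι 𝒱 v * π.ofConv a) :=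
        ι_mul_ι (proj_mem ha) hv
      rw [e1, LinearMap.convOne_apply, Algebra.algebraMap_eq_smul_one, mul_smul_comm,
        ← mul_assoc (π.ofConv a), e2]
      simp only [Units.smul_def, smul_mul_assoc, mul_smul_comm, one_mul]
      rw [smul_comm (n + 1 : K), smul_smul, ← Units.val_mul, mul_comm j i, Int.units_mul_self,
        Units.val_one, one_smul, mul_assoc]
    have h1 := LinearMap.congr_fun key (CoalgebraStruct.comul (R := K) x)
    have e0 : (π ^ (n + 1 + 1)) (ι 𝒱 v * x) = (LinearMap.mul' K (Sym 𝒱) ∘ₗ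
        TensorProduct.map π.ofConv (π ^ (n + 1)).ofConv ∘ₗ mulι₂ i v)
          (CoalgebraStruct.comul (R := K) x) := by
      rw [pow_succ' π (n + 1), conv_apply, comul_ι_mul hv]
      rfl
    have e3 := conv_apply 1 (π ^ (n + 1)) x
    have e4 := conv_apply π (π ^ n) x
    rw [one_mul] at e3
    rw [← pow_succ'] at e4
    rw [e0, h1]
    simp only [LinearMap.comp_apply, LinearMap.add_apply, LinearMap.smul_apply,
      LinearMap.mulLeft_apply]
    rw [← e3, ← e4, mul_add, mul_smul_comm, Nat.cast_succ, add_smul (n + 1 : K) 1, one_smul,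
      add_comm]

theorem divPow_toGen_proj_ι_mul [CharZero K] (n : ℕ) {i : ℤ} {v : V} (hv : v ∈ 𝒱 i) (x : Sym 𝒱) :
    divPow (n + 1) (toGen 𝒱 (proj 𝒱)) (ι 𝒱 v * x) =
      ι 𝒱 v * divPow n (toGen 𝒱 (proj 𝒱)) x := by
  simp only [divPow, ofConv_smul, LinearMap.smul_apply, toGen_proj_pow_ι_mul n hv, mul_smul_comm,
    smul_smul]
  congr 1
  have h1 : (n.factorial : K) ≠ 0 := by exact_mod_cast Nat.factorial_ne_zero _
  have h2 : (n + 1 : K) ≠ 0 := by exact_mod_cast n.succ_ne_zero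
  rw [Nat.factorial_succ]
  push_cast
  field_simp

/-- The identity is the exponential of the projection to the generators. -/
theorem convExp_toGen_proj [CharZero K] (hV : ∀ i < 1, 𝒱 i = ⊥) :
    convExp (toGen 𝒱 (proj 𝒱)) = toConv LinearMap.id := by
  have hh := toGen_mem_vanishBelow hV (fun d x hx => proj_mem (𝒱 := 𝒱) (d := d) hx)
  refine WithConv.ext (hom_ext ?_ fun i v hv x hx => ?_)
  · rw [convExp_apply hh (N := 1) (by simp) one_mem_gr, Finset.sum_range_one, divPow_zero,
      LinearMap.convOne_apply, counit_one, map_one]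
    rfl
  · suffices (convExp (toGen 𝒱 (proj 𝒱))).ofConv ∘ₗ mulι v =
        mulι v ∘ₗ (convExp (toGen 𝒱 (proj 𝒱))).ofConv by
      refine (LinearMap.congr_fun this x).trans ?_
      rw [LinearMap.comp_apply, hx]
      rfl
    clear hx
    refine linearMap_ext_graded (gr 𝒱) fun d x hx => ?_
    simp only [LinearMap.comp_apply, LinearMap.mulLeft_apply]
    have h1 := convExp_apply hh (N := d.toNat + (i + d).toNat + 1 + 1) (by omega)
      (ι_mul_mem_gr hv hx)
    have h2 := convExp_apply hh (N := d.toNat + (i + d).toNat + 1) (by omega) hx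
    rw [h1, h2, Finset.sum_range_succ', divPow_zero, LinearMap.convOne_apply, counit_ι_mul,
      map_zero, add_zero, Finset.mul_sum]
    exact Finset.sum_congr rfl fun n _ => divPow_toGen_proj_ι_mul n hv x

/-- A coalgebra morphism is determined by its corestriction to the generators. -/
theorem convExp_toGen_proj_comp [CharZero K] (hW : ∀ i < 1, 𝒲 i = ⊥) (F : Sym 𝒱 →ₗc[K] Sym 𝒲)
    (hF : ∀ d, ∀ x ∈ gr 𝒱 d, F x ∈ gr 𝒲 d) :
    convExp (toGen 𝒲 (proj 𝒲 ∘ₗ F.toLinearMap)) = toConv F.toLinearMap := by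
  have h := convExp_precomp F hF
    (toGen_mem_vanishBelow hW (fun d x hx => proj_mem (𝒱 := 𝒲) (d := d) hx))
  rw [convExp_toGen_proj hW] at h
  exact h

/-! ### Unipotent coalgebra endomorphisms -/

/-- If `k` vanishes on words of length at most one, the exponential of `proj + k` is the identity
up to terms of smaller word length. -/
theorem convExp_toGen_sub_mem_len [CharZero K] (hV : ∀ i < 1, 𝒱 i = ⊥) {k : Sym 𝒱 →ₗ[K] V}
    (hk : ∀ d, ∀ x ∈ gr 𝒱 d, k x ∈ 𝒱 d) (hk1 : ∀ x ∈ len 𝒱 1, k x = 0) {m : ℤ} {x : Sym 𝒱}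
    (hx : x ∈ len 𝒱 m) : convExp (toGen 𝒱 (proj 𝒱 + k)) x - x ∈ len 𝒱 (m - 1) := by
  have hp : ∀ d, ∀ x ∈ gr 𝒱 d, proj 𝒱 x ∈ 𝒱 d := fun d x hx => proj_mem hx
  have hkv := toGen_mem_vanishBelow hV hk
  have hι : ∀ v : V, ι 𝒱 v ∈ len 𝒱 1 := fun v => by
    refine mem_of_homogeneous 𝒱 (p := (len 𝒱 1).comap (ι 𝒱)) (fun i v hv => ?_) v
    simpa [word] using word_mem_len [(⟨i, v, hv⟩ : Σ j : ℤ, 𝒱 j)] (m := 1) (by simp)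
  have hk2 : ∀ m, ∀ x ∈ len 𝒱 m, toGen 𝒱 k x ∈ len 𝒱 (m - 1) := by
    intro m x hx
    rcases le_or_gt m 1 with hm | hm
    · rw [LinearMap.comp_apply, hk1 x (len_mono hm hx), map_zero]
      exact zero_mem _
    · exact len_mono (by omega) (hι (k x))
  have hpow : ∀ n : ℕ, ∀ m, ∀ x ∈ len 𝒱 m, (toGen 𝒱 k ^ (n + 1)) x ∈ len 𝒱 (m - (n + 1)) := by
    intro n
    induction n with
    | zero => simpa using hk2
    | succ n ih =>
      intro m x hx
      rw [pow_succ]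
      have h := conv_mem (fun d x hx => comul_mem_tensorSum_len hx)
        (fun i j x hx y hy => mul_mem_len hx hy) ih hk2 m x hx
      simpa using h
  have hexp : ∀ m, ∀ x ∈ len 𝒱 m, (convExp (toGen 𝒱 k) - 1) x ∈ len 𝒱 (m - 1) := by
    intro m x hx
    suffices len 𝒱 m ≤ (len 𝒱 (m - 1)).comap (convExp (toGen 𝒱 k) - 1).ofConv from this hx
    refine Submodule.span_le.2 ?_
    rintro _ ⟨l, hl, rfl⟩
    have h1 := convExp_apply hkv (d := (l.map fun p => p.1).sum)
      (N := (l.map fun p : Σ j : ℤ, 𝒱 j => p.1).sum.toNat + 1) (by omega)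
      (word_mem_gr l)
    simp only [Submodule.comap_coe, Set.mem_preimage, SetLike.mem_coe, ofConv_sub,
      LinearMap.sub_apply]
    rw [h1, Finset.sum_range_succ', divPow_zero, add_sub_cancel_right]
    refine Submodule.sum_mem _ fun n _ => Submodule.smul_mem _ _ ?_
    exact len_mono (by omega) (hpow n m _ (word_mem_len l hl))
  have hsum : toGen 𝒱 (proj 𝒱 + k) = toGen 𝒱 (proj 𝒱) + toGen 𝒱 k :=
    WithConv.ext (LinearMap.comp_add _ _ _)
  have hsub : convExp (toGen 𝒱 (proj 𝒱 + k)) - toConv LinearMap.id =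
      toConv LinearMap.id * (convExp (toGen 𝒱 k) - 1) := by
    rw [hsum, convExp_add (toGen_commute hp hk) (toGen_mem_vanishBelow hV hp) hkv,
      convExp_toGen_proj hV, mul_sub, mul_one]
  have h := conv_mem (a := toConv LinearMap.id) (r := 0)
    (fun d x hx => comul_mem_tensorSum_len hx) (fun i j x hx y hy => mul_mem_len hx hy)
    (fun d x hx => by rw [sub_zero]; exact hx) hexp m x hx
  rw [← hsub, zero_add] at h
  exact h

theorem bijective_of_sub_mem_len {ψ : Sym 𝒱 →ₗ[K] Sym 𝒱}
    (hψ : ∀ m, ∀ x ∈ len 𝒱 m, ψ x - x ∈ len 𝒱 (m - 1)) : Function.Bijective ψ := by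
  constructor
  · rw [← LinearMap.ker_eq_bot, Submodule.eq_bot_iff]
    have hdesc : ∀ m : ℕ, ∀ x ∈ len 𝒱 ((m : ℤ) - 1), ψ x = 0 → x = 0 := by
      intro m
      induction m with
      | zero =>
        intro x hx _
        rwa [len_of_neg (by simp), Submodule.mem_bot] at hx
      | succ m ih =>
        intro x hx h0
        have h := hψ _ x hx
        rw [h0, zero_sub, neg_mem_iff, Nat.cast_succ, add_sub_cancel_right] at h
        exact ih x h h0
    have hlen : ∀ x : Sym 𝒱, ∃ m : ℕ, x ∈ len 𝒱 m := by
      intro x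
      have h : x ∈ ⨆ m : ℕ, len 𝒱 (m : ℤ) := mem_of_word (fun l =>
        Submodule.mem_iSup_of_mem l.length (word_mem_len l le_rfl)) x
      rwa [Submodule.mem_iSup_of_directed _ (Monotone.directed_le fun a b hab =>
        len_mono (by exact_mod_cast hab))] at h
    intro x hx
    obtain ⟨m, hm⟩ := hlen x
    exact hdesc (m + 1) x (by simpa using hm) hx
  · rw [← LinearMap.range_eq_top, Submodule.eq_top_iff']
    have hasc : ∀ m : ℕ, len 𝒱 ((m : ℤ) - 1) ≤ LinearMap.range ψ := by
      intro m
      induction m with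
      | zero => rw [len_of_neg (by simp)]; exact bot_le
      | succ m ih =>
        intro x hx
        have h := hψ _ x hx
        rw [Nat.cast_succ, add_sub_cancel_right] at h
        have h1 : x = ψ x - (ψ x - x) := by abel
        rw [h1]
        exact sub_mem (LinearMap.mem_range_self ψ x) (ih h)
    exact mem_of_word fun l => hasc (l.length + 1) (word_mem_len l (by simp))

end Sym

/-! ### Sections and transport of structure -/

section Transport

variable {K : Type*} [Field K]

/-- The inverse of a bijective linear map of degree zero has degree zero. -/
theorem mem_of_map_mem {V : Type*} [AddCommGroup V] [Module K V] (𝒱 : ℤ → Submodule K V)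
    [DirectSum.Decomposition 𝒱] {f : V →ₗ[K] V} (hf : ∀ d, ∀ x ∈ 𝒱 d, f x ∈ 𝒱 d)
    (hinj : Function.Injective f) {d : ℤ} {x : V} (hx : f x ∈ 𝒱 d) : x ∈ 𝒱 d := by
  have hcomp : ∀ x i, (DirectSum.decompose 𝒱 (f x) i : V) = f (DirectSum.decompose 𝒱 x i) := by
    intro x i
    let π : V →ₗ[K] V := gradedMap 𝒱 fun j => if j = i then LinearMap.id else 0
    have hπ : ∀ y, (DirectSum.decompose 𝒱 y i : V) = π y := by
      intro y
      induction y using DirectSum.Decomposition.inductionOn 𝒱 with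
      | zero => simp
      | @homogeneous j y =>
        rw [gradedMap_apply 𝒱 _ y.2]
        split_ifs with h
        · subst h; simp
        · rw [DirectSum.decompose_of_mem_ne 𝒱 y.2 h]; rfl
      | add y z hy hz => rw [DirectSum.decompose_add, map_add, ← hy, ← hz]; rfl
    rw [hπ, hπ]
    refine LinearMap.congr_fun (f := π ∘ₗ f) (g := f ∘ₗ π)
      (Sym.linearMap_ext_graded 𝒱 fun j y hy => ?_) x
    rw [LinearMap.comp_apply, LinearMap.comp_apply, gradedMap_apply 𝒱 _ hy,
      gradedMap_apply 𝒱 _ (hf j y hy)]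
    split_ifs <;> simp
  have h1 : (DirectSum.decompose 𝒱 x d : V) = x := by
    apply hinj
    rw [← hcomp, DirectSum.decompose_of_mem_same 𝒱 hx]
  rw [← h1]
  exact SetLike.coe_mem _

/-- A surjection onto the part of degree at least `N` has a section of degree zero there. -/
theorem exists_graded_section {V : Type*} [AddCommGroup V] [Module K V] (𝒱 : ℤ → Submodule K V)
    {W : Type*} [AddCommGroup W] [Module K W] (𝒲 : ℤ → Submodule K W)
    [DirectSum.Decomposition 𝒲] {f : V →ₗ[K] W} (hf : ∀ d, ∀ x ∈ 𝒱 d, f x ∈ 𝒲 d) {N : ℤ}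
    (hsurj : ∀ d, N ≤ d → ∀ y ∈ 𝒲 d, ∃ x ∈ 𝒱 d, f x = y) :
    ∃ σ : W →ₗ[K] V, (∀ d, ∀ y ∈ 𝒲 d, σ y ∈ 𝒱 d) ∧
      ∀ d, N ≤ d → ∀ y ∈ 𝒲 d, f (σ y) = y := by
  have h : ∀ d, ∃ s : 𝒲 d →ₗ[K] 𝒱 d, N ≤ d → ∀ y, f (s y) = y := by
    intro d
    by_cases hd : N ≤ d
    · have hs : Function.Surjective (f.restrict (hf d)) := by
        rintro ⟨y, hy⟩
        obtain ⟨x, hx, rfl⟩ := hsurj d hd y hy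
        exact ⟨⟨x, hx⟩, rfl⟩
      obtain ⟨s, hs⟩ := LinearMap.exists_rightInverse_of_surjective _ (LinearMap.range_eq_top.2 hs)
      exact ⟨s, fun _ y => congrArg Subtype.val (LinearMap.congr_fun hs y)⟩
    · exact ⟨0, fun h => absurd h hd⟩
  choose s hs using h
  obtain ⟨σ, hσ⟩ : ∃ σ : W →ₗ[K] V, ∀ d, ∀ y (hy : y ∈ 𝒲 d), σ y = s d ⟨y, hy⟩ := by
    refine ⟨DirectSum.toModule K ℤ V (fun j => (𝒱 j).subtype ∘ₗ s j) ∘ₗ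
      (DirectSum.decomposeLinearEquiv 𝒲).toLinearMap, fun d y hy => ?_⟩
    lift y to 𝒲 d using hy
    simp only [LinearMap.comp_apply, LinearEquiv.coe_coe,
      DirectSum.decomposeLinearEquiv_apply, DirectSum.decompose_coe]
    rw [← DirectSum.lof_eq_of K, DirectSum.toModule_lof]
    rfl
  refine ⟨σ, fun d y hy => ?_, fun d hd y hy => ?_⟩
  · rw [hσ d y hy]
    exact SetLike.coe_mem _
  · rw [hσ d y hy]
    exact hs d hd _

variable {L : Type*} [AddCommGroup L] [Module K L] {ℒ : ℤ → Submodule K L}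
  [DirectSum.Decomposition ℒ] {L' : Type*} [AddCommGroup L'] [Module K L']
  {ℒ' : ℤ → Submodule K L'} [DirectSum.Decomposition ℒ']

theorem LInfinityHom.ext_F {A : LInfinityAlgebra ℒ} {A' : LInfinityAlgebra ℒ'}
    {f g : LInfinityHom A A'} (h : f.F = g.F) : f = g := by
  cases f; cases g; cases h; rfl

/-- The transport of an `L∞`-algebra structure along an automorphism of the graded coalgebra
`S(sL)`. -/
def LInfinityAlgebra.transport (A : LInfinityAlgebra ℒ)
    (e : Sym (susp ℒ) ≃ₗc[K] Sym (susp ℒ))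
    (he : ∀ d, ∀ x ∈ Sym.gr (susp ℒ) d, e x ∈ Sym.gr (susp ℒ) d)
    (he' : ∀ d, ∀ x ∈ Sym.gr (susp ℒ) d, e.symm x ∈ Sym.gr (susp ℒ) d) (h1 : e 1 = 1) :
    LInfinityAlgebra ℒ where
  δ := (e : Sym (susp ℒ) →ₗc[K] Sym (susp ℒ)).toLinearMap ∘ₗ A.δ ∘ₗ
    (e.symm : Sym (susp ℒ) →ₗc[K] Sym (susp ℒ)).toLinearMap
  degree i x hx := he _ _ (A.degree i _ (he' _ _ hx))
  map_one := by
    have h : e.symm 1 = 1 := by rw [← h1, CoalgEquiv.symm_apply_apply, h1]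
    change e (A.δ (e.symm 1)) = 0
    rw [h, A.map_one, map_zero]
  coderivation := by
    set E := (e : Sym (susp ℒ) →ₗc[K] Sym (susp ℒ)).toLinearMap
    set E' := (e.symm : Sym (susp ℒ) →ₗc[K] Sym (susp ℒ)).toLinearMap
    have hΔ : CoalgebraStruct.comul ∘ₗ E = TensorProduct.map E E ∘ₗ CoalgebraStruct.comul :=
      (CoalgHomClass.map_comp_comul (e : Sym (susp ℒ) →ₗc[K] Sym (susp ℒ))).symm
    have hΔ' : TensorProduct.map E' E' ∘ₗ CoalgebraStruct.comul = CoalgebraStruct.comul ∘ₗ E' :=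
      CoalgHomClass.map_comp_comul (e.symm : Sym (susp ℒ) →ₗc[K] Sym (susp ℒ))
    have hEE : E ∘ₗ E' = LinearMap.id := LinearMap.ext fun x => e.apply_symm_apply x
    have hP : E ∘ₗ parity (Sym.gr (susp ℒ)) ∘ₗ E' = parity (Sym.gr (susp ℒ)) := by
      refine Sym.linearMap_ext_graded (Sym.gr (susp ℒ)) fun d x hx => ?_
      simp only [LinearMap.comp_apply]
      have hx' : E' x ∈ Sym.gr (susp ℒ) d := he' d x hx
      rw [parity_apply_of_mem _ hx, parity_apply_of_mem _ hx', map_intUnits_smul]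
      congr 1
      exact e.apply_symm_apply x
    calc CoalgebraStruct.comul ∘ₗ E ∘ₗ A.δ ∘ₗ E'
        = TensorProduct.map E E ∘ₗ (CoalgebraStruct.comul ∘ₗ A.δ) ∘ₗ E' := by
          rw [← LinearMap.comp_assoc, hΔ]; rfl
      _ = (TensorProduct.map E E ∘ₗ (TensorProduct.map A.δ LinearMap.id +
            TensorProduct.map (parity (Sym.gr (susp ℒ))) A.δ) ∘ₗ TensorProduct.map E' E') ∘ₗ
              CoalgebraStruct.comul := by
          rw [A.coderivation, LinearMap.comp_assoc, ← hΔ']; rfl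
      _ = _ := by
          congr 1
          rw [LinearMap.add_comp, LinearMap.comp_add, ← TensorProduct.map_comp,
            ← TensorProduct.map_comp, ← TensorProduct.map_comp, ← TensorProduct.map_comp,
            LinearMap.id_comp, hEE, hP]
  sq_zero := by
    ext x
    have h := LinearMap.congr_fun A.sq_zero (e.symm x)
    change e (A.δ (e.symm (e (A.δ (e.symm x))))) = 0
    rw [CoalgEquiv.symm_apply_apply]
    exact (congrArg e h).trans (map_zero e)

/-- Transport along a coalgebra automorphism produces an isomorphic `L∞`-algebra. -/
theorem LInfinityAlgebra.exists_iso_of_coalgEquiv (A : LInfinityAlgebra ℒ)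
    (e : Sym (susp ℒ) ≃ₗc[K] Sym (susp ℒ))
    (he : ∀ d, ∀ x ∈ Sym.gr (susp ℒ) d, e x ∈ Sym.gr (susp ℒ) d) (h1 : e 1 = 1)
    (hlin : ∀ v, e (Sym.ι (susp ℒ) v) = Sym.ι (susp ℒ) v) :
    ∃ (B : LInfinityAlgebra ℒ) (φ : LInfinityHom B A), φ.IsIso ∧ ∀ x, φ.F x = e.symm x := by
  have he' : ∀ d, ∀ x ∈ Sym.gr (susp ℒ) d, e.symm x ∈ Sym.gr (susp ℒ) d := fun d x hx =>
    mem_of_map_mem (Sym.gr (susp ℒ)) (f := (e : Sym (susp ℒ) →ₗc[K] Sym (susp ℒ)).toLinearMap)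
      he e.injective (by
        change e (e.symm x) ∈ _
        rwa [CoalgEquiv.apply_symm_apply])
  have h1' : e.symm 1 = 1 := by rw [← h1, CoalgEquiv.symm_apply_apply, h1]
  let B := A.transport e he he' h1
  let φ : LInfinityHom B A :=
    { F := e.symm
      degree := he'
      map_one := h1'
      comm := by
        ext x
        exact e.symm_apply_apply _ }
  let φ' : LInfinityHom A B :=
    { F := e
      degree := he
      map_one := h1
      comm := by
        ext x
        change e (A.δ x) = e (A.δ (e.symm (e x)))
        rw [CoalgEquiv.symm_apply_apply] }
  refine ⟨B, φ, ⟨?_, φ', ?_, ?_⟩, fun _ => rfl⟩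
  · have h : φ.linearPart = LinearMap.id := by
      ext v
      change Sym.proj _ (e.symm (Sym.ι _ v)) = v
      rw [← hlin v, CoalgEquiv.symm_apply_apply, Sym.proj_ι]
    rw [h]
    exact Function.bijective_id
  · refine LInfinityHom.ext_F (CoalgHom.ext fun x => ?_)
    exact e.symm_apply_apply x
  · refine LInfinityHom.ext_F (CoalgHom.ext fun x => ?_)
    exact e.apply_symm_apply x

end Transport

/-! ### Straightening a coalgebra morphism -/

namespace Sym

open WithConv

variable {K : Type*} [Field K] {V : Type*} [AddCommGroup V] [Module K V]
  {𝒱 : ℤ → Submodule K V} [DirectSum.Decomposition 𝒱]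
  {W : Type*} [AddCommGroup W] [Module K W]
  {𝒲 : ℤ → Submodule K W} [DirectSum.Decomposition 𝒲]

/-- The algebra morphism `S(f) : S(V) → S(W)` induced by a linear map of degree zero. -/
def map (f : V →ₗ[K] W) (hf : ∀ d, ∀ x ∈ 𝒱 d, f x ∈ 𝒲 d) : Sym 𝒱 →ₐ[K] Sym 𝒲 :=
  lift (𝒱 := 𝒱) (ι 𝒲 ∘ₗ f) fun _ _ _ _ hv hw => ι_mul_ι (hf _ _ hv) (hf _ _ hw)

omit [DirectSum.Decomposition 𝒱] [DirectSum.Decomposition 𝒲] in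
theorem map_ι (f : V →ₗ[K] W) (hf : ∀ d, ∀ x ∈ 𝒱 d, f x ∈ 𝒲 d) (v : V) :
    map f hf (ι 𝒱 v) = ι 𝒲 (f v) := lift_ι _ _ v

omit [DirectSum.Decomposition 𝒱] in
/-- If the generators have positive degree, words of length at least two have degree at least two,
so that a linear map vanishing on words of length at most one vanishes in degrees at most one. -/
theorem eq_zero_of_mem_gr_of_le_one (hV : ∀ i < 1, 𝒱 i = ⊥) {M : Type*} [AddCommGroup M] [Module K M]
    {p : Sym 𝒱 →ₗ[K] M} (hp : ∀ x ∈ len 𝒱 1, p x = 0) {d : ℤ} (hd : d ≤ 1) {x : Sym 𝒱}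
    (hx : x ∈ gr 𝒱 d) : p x = 0 := by
  have hdeg : ∀ l : List (Σ j : ℤ, 𝒱 j), (l.map fun p => p.1).sum < l.length → word l = 0 := by
    intro l
    induction l with
    | nil => simp
    | cons q l ih =>
      intro h
      rw [word_cons]
      rcases lt_or_ge q.1 1 with hq | hq
      · have h0 := q.2.2
        have h1 := (hV _ hq).le h0
        rw [(Submodule.mem_bot K).1 h1, map_zero, zero_mul]
      · rw [ih (by simp at h; omega), mul_zero]
  suffices gr 𝒱 d ≤ LinearMap.ker p from this hx
  rw [gr_eq_span, Submodule.span_le]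
  rintro _ ⟨l, rfl, rfl⟩
  rw [SetLike.mem_coe, LinearMap.mem_ker]
  rcases le_or_gt (l.length : ℤ) 1 with hl | hl
  · exact hp _ (word_mem_len l hl)
  · rw [hdeg l (by omega), map_zero]

omit [DirectSum.Decomposition 𝒱] in
theorem eq_zero_of_mem_len_one {M : Type*} [AddCommGroup M] [Module K M] {p : Sym 𝒱 →ₗ[K] M}
    (h1 : p 1 = 0) (hι : ∀ v, p (ι 𝒱 v) = 0) {x : Sym 𝒱} (hx : x ∈ len 𝒱 1) : p x = 0 := by
  suffices len 𝒱 1 ≤ LinearMap.ker p from this hx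
  refine Submodule.span_le.2 ?_
  rintro _ ⟨l, hl, rfl⟩
  rw [SetLike.mem_coe, LinearMap.mem_ker]
  match l with
  | [] => rw [word_nil, h1]
  | [q] => rw [word_cons, word_nil, mul_one, hι]
  | q :: r :: l => simp at hl; omega

/-- A coalgebra morphism `F : S(V) → S(W)` whose linear part `F₁` is surjective in degrees at
least two becomes `S(F₁)` after composition with an automorphism of `S(V)` with trivial linear
part. -/
theorem exists_coalgEquiv_map_comp [CharZero K] (hV : ∀ i < 1, 𝒱 i = ⊥) (hW : ∀ i < 1, 𝒲 i = ⊥)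
    (F : Sym 𝒱 →ₗc[K] Sym 𝒲) (hF : ∀ d, ∀ x ∈ gr 𝒱 d, F x ∈ gr 𝒲 d) (hF1 : F 1 = 1)
    {f : V →ₗ[K] W} (hf : ∀ d, ∀ x ∈ 𝒱 d, f x ∈ 𝒲 d) (hfF : ∀ v, proj 𝒲 (F (ι 𝒱 v)) = f v)
    (hsurj : ∀ d, 2 ≤ d → ∀ y ∈ 𝒲 d, ∃ x ∈ 𝒱 d, f x = y) :
    ∃ e : Sym 𝒱 ≃ₗc[K] Sym 𝒱, (∀ d, ∀ x ∈ gr 𝒱 d, e x ∈ gr 𝒱 d) ∧ e 1 = 1 ∧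
      (∀ v, e (ι 𝒱 v) = ι 𝒱 v) ∧ ∀ x, map f hf (e x) = F x := by
  obtain ⟨σ, hσ, hfσ⟩ := exists_graded_section 𝒱 𝒲 hf hsurj
  -- The part of the corestriction of `F` on words of length at least two.
  set p : Sym 𝒱 →ₗ[K] W := proj 𝒲 ∘ₗ F.toLinearMap - f ∘ₗ proj 𝒱
  have hp : ∀ d, ∀ x ∈ gr 𝒱 d, p x ∈ 𝒲 d := fun d x hx =>
    sub_mem (proj_mem (hF d x hx)) (hf d _ (proj_mem hx))
  have hp1 : ∀ x ∈ len 𝒱 1, p x = 0 := fun x hx => by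
    refine eq_zero_of_mem_len_one ?_ (fun v => ?_) hx
    · change proj 𝒲 (F 1) - f (proj 𝒱 1) = 0
      rw [hF1, proj_one, proj_one, map_zero, sub_zero]
    · change proj 𝒲 (F (ι 𝒱 v)) - f (proj 𝒱 (ι 𝒱 v)) = 0
      rw [hfF, proj_ι, sub_self]
  -- Words of length at least two have degree at least two, where `f` is surjective.
  have hfp : ∀ x, f (σ (p x)) = p x := by
    refine LinearMap.congr_fun (f := f ∘ₗ σ ∘ₗ p) (linearMap_ext_graded (gr 𝒱) fun d x hx => ?_)
    rcases le_or_gt 2 d with hd | hd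
    · exact hfσ d hd _ (hp d x hx)
    · rw [LinearMap.comp_apply, LinearMap.comp_apply,
        eq_zero_of_mem_gr_of_le_one hV hp1 (by omega) hx, map_zero, map_zero]
  have hk : ∀ d, ∀ x ∈ gr 𝒱 d, (σ ∘ₗ p) x ∈ 𝒱 d := fun d x hx => hσ d _ (hp d x hx)
  have hk1 : ∀ x ∈ len 𝒱 1, (σ ∘ₗ p) x = 0 := fun x hx => by
    rw [LinearMap.comp_apply, hp1 x hx, map_zero]
  set g : Sym 𝒱 →ₗ[K] V := proj 𝒱 + σ ∘ₗ p
  have hg' : ∀ d, ∀ x ∈ gr 𝒱 d, g x ∈ 𝒱 d := fun d x hx => add_mem (proj_mem hx) (hk d x hx)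
  set ψ := coalgHomOf hV g hg'
  have hlen : ∀ m, ∀ x ∈ len 𝒱 m, ψ x - x ∈ len 𝒱 (m - 1) := fun m x hx =>
    convExp_toGen_sub_mem_len hV hk hk1 hx
  have hψ1 : ψ 1 = 1 := by
    have h := hlen 0 1 (word_mem_len [] (by simp))
    rw [len_of_neg (by simp), Submodule.mem_bot] at h
    exact sub_eq_zero.1 h
  have hψι : ∀ v, ψ (ι 𝒱 v) = ι 𝒱 v := by
    refine LinearMap.congr_fun (f := ψ.toLinearMap ∘ₗ ι 𝒱)
      (linearMap_ext_graded 𝒱 fun i v hv => sub_eq_zero.1 ?_)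
    have h1 : ι 𝒱 v ∈ len 𝒱 1 := by
      simpa [word] using word_mem_len [(⟨i, v, hv⟩ : Σ j : ℤ, 𝒱 j)] (m := 1) (by simp)
    -- The difference is a scalar, and the counit kills it.
    have h2 : ∃ c : K, c • 1 = ψ (ι 𝒱 v) - ι 𝒱 v := by
      refine Submodule.mem_span_singleton.1 (Submodule.span_mono ?_ (hlen 1 _ h1))
      rintro _ ⟨l, hl, rfl⟩
      rw [List.length_eq_zero_iff.1 (by omega : l.length = 0)]
      rfl
    obtain ⟨c, hc⟩ := h2
    have h3 : CoalgebraStruct.counit (R := K) (ι 𝒱 v) = 0 := by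
      rw [← mul_one (ι 𝒱 v), counit_ι_mul]
    have h4 := congrArg (CoalgebraStruct.counit (R := K)) hc
    rw [map_sub, CoalgHomClass.counit_comp_apply, sub_self, map_smul, counit_one, smul_eq_mul,
      mul_one] at h4
    rw [h4, zero_smul] at hc
    exact hc.symm
  refine ⟨CoalgEquiv.ofBijective (f := ψ) (bijective_of_sub_mem_len hlen),
    fun d x hx => convExp_toGen_mem_gr hV hg' hx, hψ1, hψι, fun x => ?_⟩
  have h1 : postcomp (map f hf) (toGen 𝒱 g) = toGen 𝒲 (proj 𝒲 ∘ₗ F.toLinearMap) := by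
    refine WithConv.ext (LinearMap.ext fun x => ?_)
    change map f hf (ι 𝒱 (proj 𝒱 x + σ (p x))) = ι 𝒲 (proj 𝒲 (F x))
    rw [map_ι, map_add, hfp]
    congr 1
    exact add_sub_cancel _ _
  have h2 := convExp_postcomp (map f hf) (toGen_mem_vanishBelow hV hg')
  rw [h1, convExp_toGen_proj_comp hW F hF] at h2
  exact (congrArg (fun f => f.ofConv x) h2).symm

end Sym

end LieInfinity

end

theorem mainTheorem5 {K : Type*} [Field K] [CharZero K] (n : ℕ∞)
    {L : Type*} [AddCommGroup L] [Module K L] (ℒ : ℤ → Submodule K L) [DirectSum.Decomposition ℒ]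
    {L' : Type*} [AddCommGroup L'] [Module K L'] (ℒ' : ℤ → Submodule K L')
    [DirectSum.Decomposition ℒ']
    (hL : LieInfinity.IsConcentrated ℒ n) (hL' : LieInfinity.IsConcentrated ℒ' n)
    (A : LieInfinity.LInfinityAlgebra ℒ) (A' : LieInfinity.LInfinityAlgebra ℒ')
    (f : LieInfinity.LInfinityHom A A') (hf : f.IsFibration) :
    ∃ (B : LieInfinity.LInfinityAlgebra ℒ) (φ : LieInfinity.LInfinityHom B A),
      φ.IsIso ∧ (f.comp φ).IsStrict ∧ (f.comp φ).IsFibration ∧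
        (f.comp φ).linearPart = f.linearPart := by
  have hV : ∀ i < 1, LieInfinity.susp ℒ i = ⊥ := fun i hi => by
    by_contra h
    have := (hL (i - 1) h).1
    omega
  have hW : ∀ i < 1, LieInfinity.susp ℒ' i = ⊥ := fun i hi => by
    by_contra h
    have := (hL' (i - 1) h).1
    omega
  have hdeg : ∀ d, ∀ x ∈ LieInfinity.susp ℒ d, f.linearPart x ∈ LieInfinity.susp ℒ' d := fun d x hx =>
    LieInfinity.Sym.proj_mem (f.degree d _ (LieInfinity.Sym.ι_mem_gr _ hx))
  obtain ⟨e, he, he1, heι, hfe⟩ := LieInfinity.Sym.exists_coalgEquiv_map_comp hV hW f.F f.degree f.map_one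
    hdeg (fun _ => rfl) (fun d hd y hy => hf (d - 1) (by omega) y hy)
  obtain ⟨B, φ, hφ, hφe⟩ := A.exists_iso_of_coalgEquiv e he he1 heι
  have hcomp : ∀ x, (f.comp φ).F x = LieInfinity.Sym.map f.linearPart hdeg x := fun x => by
    rw [← CoalgEquiv.apply_symm_apply e x, hfe, CoalgEquiv.apply_symm_apply, ← hφe]
    rfl
  have hlin : (f.comp φ).linearPart = f.linearPart := by
    ext v
    refine (congrArg (LieInfinity.Sym.proj (LieInfinity.susp ℒ')) (hcomp (LieInfinity.Sym.ι (LieInfinity.susp ℒ) v))).trans ?_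
    rw [LieInfinity.Sym.map_ι, LieInfinity.Sym.proj_ι]
  refine ⟨B, φ, hφ, fun k hk => ?_, fun i hi y hy => ?_, hlin⟩
  · obtain ⟨k, rfl⟩ := Nat.exists_eq_add_of_le' hk
    ext x
    refine (congrArg (LieInfinity.Sym.proj (LieInfinity.susp ℒ')) (hcomp _)).trans ?_
    simp only [MultilinearMap.compLinearMap_apply, MultilinearMap.mkPiAlgebraFin_apply,
      List.ofFn_succ, List.prod_cons, map_mul, LinearMap.comp_apply, LieInfinity.Sym.map_ι,
      LieInfinity.Sym.proj_ι_mul_ι_mul, zero_apply]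
  · rw [hlin]
    exact hf i hi y hy
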